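/- Let $Z_n$ be the zigzag poset on $\{z_1,\dots,z_n\}$ with cover relations $z_1>z_2<z_3>z_4<\cdots$, let $\Omega(Z_n;t)\in\mathbb Q[t]$ be its order polynomial (the unique polynomial whose value at a natural number $t$ is the number of order-preserving maps $Z_n\to\{1<\dots<t\}$), and let $E_k$ be the number of linear extensions of $Z_k$. A convex subposet of a finite poset $P$ is a subset that is connected (in particular non-empty) with the induced order and contains every $b$ with $a\le b\le c$ whenever it contains $a$ and $c$. A decomposition of $P$ into $k$ convex subposets is a partition of $P$ into $k$ such blocks; for blocks $A,B$ write $A\,\tilde\le\, B$ if $a\le b$ for some $a\in A$, $b\in B$. The decomposition is standard if there are no $r\ge 2$ distinct blocks with $B_1\,\tilde\le\, B_2\,\tilde\le\cdots\tilde\le\, B_r\,\tilde\le\, B_1$. Let $\mathsf{SDecompo}_k(P)$ be the set of standard decompositions of $P$ into $k$ convex subposets. For $k\ge 0$ put $$w_+(2k+1)=\frac{(k!)^2}{(2k+1)!},\qquad w_-(1)=1,\quad w_-(2k+1)=-\frac{(k!)^2}{2k\,(2k+1)!}\ (k\ge1),\qquad U_{2k+1}=\frac{1}{(2k+1)\,2^{4k}}\binom{2k}{k}.$$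 Let $n\ge2$. Call the maximal elements of $Z_n$ (the $z_i$ with $i$ odd) upper and its minimal elements (the $z_i$ with $i$ even) lower. Call a block of a decomposition of $Z_n$ special if $n$ is even and the block contains $z_n$ (it is the rightmost block). The weight $w(B)$ of a block $B$ with $m$ elements is $0$ if $m$ is even; $w_-(m)$ if $m$ is odd and $B$ has more upper than lower elements; and, if $m$ is odd and $B$ has more lower than upper elements, $U_m$ if $B$ is special and $w_+(m)$ otherwise. For a decomposition $\mu$ let $w(\mu)=\prod_{B\in\mu}w(B)$. Then for all $n\ge 2$ and $1\le k\le n$, $$n!\,[t^k]\,\Omega(Z_n;t-\tfrac12)=\frac{n!}{k!}\,E_k\sum_{\mu\in\mathsf{SDecompo}_k(Z_n)}w(\mu).$$ As a consequence, $\Omega(Z_n;t-\tfrac12)$ is an even polynomial in $t$ if $n$ is even and an odd polynomial in $t$ if $n$ is odd. -/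

import Mathlib

/-! ### Order polynomials -/

section OrderPolynomial

/-- The number of order-preserving surjections from `P` onto a chain with `k` elements. -/
noncomputable def surjCount (P : Type*) [PartialOrder P] (k : ℕ) : ℕ :=
  Nat.card {f : P →o Fin k // Function.Surjective f}

theorem card_orderHom_fin (P : Type*) [PartialOrder P] [Finite P] (t : ℕ) :
    Nat.card (P →o Fin t) = ∑ k ∈ Finset.range (t + 1), t.choose k * surjCount P k := by
  classical
  have hfin : Finite (P →o Fin t) := Finite.of_injective (fun f => (f : P → Fin t))
    DFunLike.coe_injective
  have key : ∀ S : Finset (Fin t),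
      Nat.card {f : P →o Fin t // Set.range f = (S : Set (Fin t))} = surjCount P S.card := by
    intro S
    refine Nat.card_congr ?_
    let e : Fin S.card ≃o S := S.orderIsoOfFin rfl
    refine
      { toFun := fun f => ⟨⟨fun x => e.symm ⟨f.1 x, ?_⟩, ?_⟩, ?_⟩
        invFun := fun g => ⟨⟨fun x => (e (g.1 x) : Fin t), ?_⟩, ?_⟩
        left_inv := ?_
        right_inv := ?_ }
    · have : f.1 x ∈ (S : Set (Fin t)) := f.2.le ⟨x, rfl⟩
      exact this
    · intro x y hxy
      exact e.symm.monotone (f.1.monotone hxy)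
    · intro i
      have hi : ((e i : S) : Fin t) ∈ Set.range f.1 := by rw [f.2]; exact (e i).2
      obtain ⟨x, hx⟩ := hi
      refine ⟨x, ?_⟩
      change e.symm ⟨f.1 x, _⟩ = i
      rw [OrderIso.symm_apply_eq]
      exact Subtype.ext hx
    · intro x y hxy
      exact e.monotone (g.1.monotone hxy)
    · ext s
      constructor
      · rintro ⟨x, rfl⟩
        exact (e (g.1 x)).2
      · intro hs
        obtain ⟨x, hx⟩ := g.2 (e.symm ⟨s, hs⟩)
        refine ⟨x, ?_⟩
        change ((e (g.1 x) : S) : Fin t) = s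
        rw [hx, OrderIso.apply_symm_apply]
    · intro f
      refine Subtype.ext (OrderHom.ext _ _ (funext fun x => ?_))
      change ((e (e.symm ⟨f.1 x, _⟩) : S) : Fin t) = f.1 x
      rw [OrderIso.apply_symm_apply]
    · intro g
      refine Subtype.ext (OrderHom.ext _ _ (funext fun x => ?_))
      change e.symm (e (g.1 x)) = g.1 x
      rw [OrderIso.symm_apply_apply]
  have h1 : Nat.card (P →o Fin t) = ∑ S : Finset (Fin t), surjCount P S.card := by
    have e : (P →o Fin t) ≃
        (Σ S : Finset (Fin t), {f : P →o Fin t // Set.range f = (S : Set (Fin t))}) :=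
      { toFun := fun f => ⟨(Set.range f).toFinset, f, by simp⟩
        invFun := fun p => p.2.1
        left_inv := fun f => rfl
        right_inv := by
          rintro ⟨S, f, hf⟩
          have : (Set.range f).toFinset = S := by
            apply Finset.coe_injective
            simpa using hf
          subst this
          rfl }
    rw [Nat.card_congr e, Nat.card_sigma]
    exact Finset.sum_congr rfl fun S _ => key S
  rw [h1, ← Finset.powerset_univ, Finset.sum_powerset_apply_card]
  simp

/-- The function counting order-preserving maps from a finite poset `P` to a chain with `t` elements
is given by a unique rational polynomial in `t`. -/
theorem existsUnique_orderPolynomial (P : Type*) [PartialOrder P] [Finite P] :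
    ∃! p : Polynomial ℚ, ∀ t : ℕ, p.eval (t : ℚ) = (Nat.card (P →o Fin t) : ℚ) := by
  classical
  have hex : ∃ p : Polynomial ℚ, ∀ t : ℕ, p.eval (t : ℚ) = (Nat.card (P →o Fin t) : ℚ) := by
    refine ⟨∑ k ∈ Finset.range (Nat.card P + 1),
      Polynomial.C ((surjCount P k : ℚ) / (k.factorial : ℚ)) * descPochhammer ℚ k, ?_⟩
    intro t
    have hzero : ∀ k, Nat.card P < k → surjCount P k = 0 := by
      intro k hk
      have : IsEmpty {f : P →o Fin k // Function.Surjective f} := by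
        refine ⟨fun f => ?_⟩
        have := Nat.card_le_card_of_surjective _ f.2
        simp at this
        omega
      simp [surjCount]
    have hext : ∀ N M : ℕ, N ≤ M →
        (∀ k, N < k → t.choose k * surjCount P k = 0) →
        ∑ k ∈ Finset.range (N + 1), t.choose k * surjCount P k =
          ∑ k ∈ Finset.range (M + 1), t.choose k * surjCount P k := by
      intro N M hNM h
      refine Finset.sum_subset (Finset.range_mono (by omega)) fun k _ hk => h k ?_
      simp at hk
      omega
    have hsum : Nat.card (P →o Fin t) =
        ∑ k ∈ Finset.range (Nat.card P + 1), t.choose k * surjCount P k := by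
      rw [card_orderHom_fin,
        hext t (max t (Nat.card P)) (le_max_left _ _)
          (fun k hk => by rw [Nat.choose_eq_zero_of_lt hk, zero_mul]),
        hext (Nat.card P) (max t (Nat.card P)) (le_max_right _ _)
          (fun k hk => by rw [hzero k hk, mul_zero])]
    rw [hsum, Polynomial.eval_finsetSum]
    push_cast
    refine Finset.sum_congr rfl fun k _ => ?_
    rw [Polynomial.eval_mul, Polynomial.eval_C, descPochhammer_eval_eq_descFactorial,
      Nat.descFactorial_eq_factorial_mul_choose]
    have : (k.factorial : ℚ) ≠ 0 := by exact_mod_cast k.factorial_ne_zero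
    push_cast
    field_simp
  obtain ⟨p, hp⟩ := hex
  refine ⟨p, hp, fun q hq => Polynomial.eq_of_infinite_eval_eq _ _ ?_⟩
  refine (Set.infinite_range_of_injective (Nat.cast_injective (R := ℚ))).mono ?_
  rintro _ ⟨t, rfl⟩
  rw [Set.mem_ofPred_eq, hq t, hp t]

/-- The order polynomial `Ω(P; t)`: the unique polynomial in `ℚ[t]` whose value at each natural
number `t` is the number of order-preserving maps from `P` to a chain with `t` elements. -/
noncomputable def orderPolynomial (P : Type*) [PartialOrder P] [Finite P] : Polynomial ℚ :=
  (existsUnique_orderPolynomial P).choose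

theorem orderPolynomial_eval (P : Type*) [PartialOrder P] [Finite P] (t : ℕ) :
    (orderPolynomial P).eval (t : ℚ) = (Nat.card (P →o Fin t) : ℚ) :=
  (existsUnique_orderPolynomial P).choose_spec.1 t

end OrderPolynomial

/-- The number `e(P)` of linear extensions of a finite poset `P`: surjective increasing maps from
`P` to a chain with `|P|` elements. -/
noncomputable def linearExtensionCount (P : Type*) [PartialOrder P] : ℕ :=
  Nat.card {f : P →o Fin (Nat.card P) // Function.Surjective f}

/-! ### Standard decompositions into convex subposets -/

section Decompositions

/-- The comparability graph of a poset. -/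
def comparabilityGraph (P : Type*) [PartialOrder P] : SimpleGraph P :=
  SimpleGraph.fromRel fun a b : P => a ≤ b

/-- `B` is (the ground set of) a convex subposet of `P`: with the induced order it is connected (in
particular non-empty), and it is order-convex in `P`. -/
def IsConvexSubposet {P : Type*} [PartialOrder P] (B : Finset P) : Prop :=
  ((comparabilityGraph P).induce (B : Set P)).Connected ∧ (B : Set P).OrdConnected

/-- The relation `A ≤̃ B` between blocks: some element of `A` is below some element of `B`. -/
def BlockLE {P : Type*} [PartialOrder P] (A B : Finset P) : Prop :=
  ∃ a ∈ A, ∃ b ∈ B, a ≤ b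

variable {P : Type*} [PartialOrder P] [Fintype P] [DecidableEq P]

/-- A partition of `P` is a decomposition into convex subposets. -/
def IsConvexDecomposition (μ : Finpartition (Finset.univ : Finset P)) : Prop :=
  ∀ B ∈ μ.parts, IsConvexSubposet B

/-- There are no `r + 2 ≥ 2` distinct blocks `c 0, …, c (r + 1)` with
`c 0 ≤̃ c 1 ≤̃ ⋯ ≤̃ c (r + 1) ≤̃ c 0` (addition in `Fin (r + 2)` is cyclic). -/
def NoBlockCycle (μ : Finpartition (Finset.univ : Finset P)) : Prop :=
  ¬ ∃ (r : ℕ) (c : Fin (r + 2) → Finset P), Function.Injective c ∧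
    (∀ i, c i ∈ μ.parts) ∧ ∀ i, BlockLE (c i) (c (i + 1))

variable (P) in
open Classical in
/-- The set of standard decompositions of `P` into `k` convex subposets. -/
noncomputable def SDecompo (k : ℕ) : Finset (Finpartition (Finset.univ : Finset P)) :=
  Finset.univ.filter fun μ => μ.parts.card = k ∧ IsConvexDecomposition μ ∧ NoBlockCycle μ

end Decompositions

/-! ### Zigzag posets -/

/-- The ground set of the zigzag poset `Z_n`; the label `i : Fin n` stands for `z_{i+1}`. -/
def Zigzag (n : ℕ) : Type := Fin n

namespace Zigzag

/-- The index of an element, starting from `0`. -/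
def idx {n : ℕ} (x : Zigzag n) : ℕ := Fin.val (n := n) x

theorem idx_injective {n : ℕ} : Function.Injective (idx : Zigzag n → ℕ) :=
  fun _ _ h => Fin.ext h

instance (n : ℕ) : Fintype (Zigzag n) := inferInstanceAs (Fintype (Fin n))

instance (n : ℕ) : DecidableEq (Zigzag n) := inferInstanceAs (DecidableEq (Fin n))

/-- The zigzag order `z_1 > z_2 < z_3 > z_4 < ⋯`: apart from equality, `z_{2j}` is below its
neighbours `z_{2j-1}` and `z_{2j+1}`, and there are no other relations. -/
instance (n : ℕ) : PartialOrder (Zigzag n) where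
  le x y := x = y ∨ (Odd x.idx ∧ (y.idx + 1 = x.idx ∨ y.idx = x.idx + 1))
  le_refl x := Or.inl rfl
  le_trans := by
    rintro x y z (rfl | ⟨hx, hxy⟩) (rfl | ⟨hy, hyz⟩)
    · exact Or.inl rfl
    · exact Or.inr ⟨hy, hyz⟩
    · exact Or.inr ⟨hx, hxy⟩
    · exfalso
      obtain ⟨a, ha⟩ := hx
      obtain ⟨b, hb⟩ := hy
      omega
  le_antisymm := by
    rintro x y (rfl | ⟨hx, hxy⟩) (h | ⟨hy, hyz⟩)
    · rfl
    · rfl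
    · exact h.symm
    · exfalso
      obtain ⟨a, ha⟩ := hx
      obtain ⟨b, hb⟩ := hy
      omega

end Zigzag

/-- The Euler number `E_n`, the number of linear extensions of `Z_n`. -/
noncomputable def eulerZigzag (n : ℕ) : ℕ := linearExtensionCount (Zigzag n)

/-! ### Weights -/

/-- `w_+(2k+1) = (k!)^2 / (2k+1)!`. Only used for odd `m`, where `k = m / 2`. -/
def wPlus (m : ℕ) : ℚ := ((m / 2).factorial : ℚ) ^ 2 / (m.factorial : ℚ)

/-- `w_-(1) = 1` and `w_-(2k+1) = -(k!)^2 / (2k (2k+1)!)` for `k ≥ 1`. Only used for odd `m`, where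
`k = m / 2`. -/
def wMinus (m : ℕ) : ℚ :=
  if m = 1 then 1
  else -((m / 2).factorial : ℚ) ^ 2 / (2 * ((m / 2 : ℕ) : ℚ) * (m.factorial : ℚ))

/-- `U_{2k+1} = (2k choose k) / ((2k+1) 2^{4k})`, the coefficient of `z^{2k+1}` in
`2 arcsin (z/2)`. Only used for odd `m`, where `k = m / 2`. -/
def uCoeff (m : ℕ) : ℚ := ((m / 2).centralBinom : ℚ) / ((m : ℚ) * 2 ^ (4 * (m / 2)))

/-- A block of a decomposition of `Z_n` is special if `n` is even and it is the rightmost block,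
that is, it contains `z_n`. -/
def IsSpecialBlock {n : ℕ} (B : Finset (Zigzag n)) : Prop :=
  Even n ∧ ∃ x ∈ B, x.idx + 1 = n

open Classical in
/-- The weight of a block. The upper elements of `Z_n` are its maximal elements, the lower elements
are its minimal elements. -/
noncomputable def blockWeight {n : ℕ} (B : Finset (Zigzag n)) : ℚ :=
  if Even B.card then 0
  else if (B.filter fun x => IsMin x).card < (B.filter fun x => IsMax x).card then wMinus B.card
  else if IsSpecialBlock B then uCoeff B.card
  else wPlus B.card

/-- The weight of a decomposition: the product of the weights of its blocks. -/
noncomputable def decompositionWeight {n : ℕ}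
    (μ : Finpartition (Finset.univ : Finset (Zigzag n))) : ℚ :=
  ∏ B ∈ μ.parts, blockWeight B

/-- The polynomial `Ω(Z_n; t - 1/2)` in `t`. -/
noncomputable def shiftedZigzagPolynomial (n : ℕ) : Polynomial ℚ :=
  (orderPolynomial (Zigzag n)).comp (Polynomial.X - Polynomial.C (1 / 2))

/-! Put `θ = 2 arcsin (z/2)` and `c = cos (θ/2) = (1 - z²/4)^(1/2)`. Both sides of the coefficient
formula reduce to `E_k / k!` times the coefficient of `z^n` in `c θ^k`.

Order polynomial: reversing the values of a zigzag sequence after deleting its first entry gives,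
for the generating function `F_v` of sequences whose first entry is among the `v` largest of `s`
values, the recursion `F_{v+1} = F_v + z F_{s-v}`, `F_0 = 1`. Since `z = 2 sin (θ/2)`,
product-to-sum formulas solve it: `F_v = (cos ((s + 1/2 - v) θ) + sin (v θ)) / cos ((s + 1/2) θ)`.
Hence `F_s = c (sec + tan)((s + 1/2) θ) - z/2` (`two_mul_zigzagSeries_self`). The half-integer `s +
1/2` is the reason for the shift of the argument: with `t = s + 1/2`, the coefficient of `z^n` is a
polynomial in `t` whose `t^k`-coefficient, for `k ≥ 1`, is the `k`-th coefficient of `sec + tan`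
times that of `z^n` in `c θ^k`. The case `n = k` compares leading coefficients and identifies the
first factor as `E_k / k!` (`coeff_secAddTan`). Parity follows because `c` is even and `θ` is odd;
the term `-z/2` affects only `n = 1`.

Decompositions: convex subposets of `Z_n` are intervals, and every partition into intervals is
standard (`noBlockCycle_zigzag`). Only blocks of odd size count, so blocks with an upper and with a
lower majority alternate from left to right, starting with upper. Their weight series are `W₋ = θ c`
and `W₊ = θ / c`, with product `θ²`. For `n` odd, `k` must be odd and the sum is the coefficient of
`z^n` in `θ^(k-1) · θ c`. For `n` even, `k` must be even; the first `k - 1` blocks give `c θ^(k-1)`,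
and the special last block supplies the factor `θ`. -/

/-- The power series of `2 arcsin (z / 2)`. -/
noncomputable def thetaSeries : PowerSeries ℚ :=
  PowerSeries.mk fun n => if Even n then 0 else uCoeff n

/-- The generating function of the weights `wPlus m` for odd `m`. -/
noncomputable def wPlusSeries : PowerSeries ℚ :=
  PowerSeries.mk fun n => if Even n then 0 else wPlus n

/-- The generating function of the weights `wMinus m` for odd `m`. -/
noncomputable def wMinusSeries : PowerSeries ℚ :=
  PowerSeries.mk fun n => if Even n then 0 else wMinus n

/-- The power series of `(1 - z ^ 2 / 4) ^ (-1 / 2)`. -/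
noncomputable def thetaDeriv : PowerSeries ℚ :=
  PowerSeries.derivative ℚ thetaSeries

/-- The power series of `(1 - z ^ 2 / 4) ^ (1 / 2) = cos (arcsin (z / 2))`. -/
noncomputable def cosHalfTheta : PowerSeries ℚ := thetaDeriv⁻¹

/-! ### Rational power series for `θ`, `cos (θ/2)` and the block weights -/

section SeriesIdentities

open PowerSeries

theorem coeff_thetaDeriv_odd (k : ℕ) : coeff (2 * k + 1) thetaDeriv = 0 := by
  rw [thetaDeriv, coeff_derivative, thetaSeries, coeff_mk, if_pos (by use k + 1; ring), zero_mul]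

theorem coeff_thetaDeriv_even (k : ℕ) :
    coeff (2 * k) thetaDeriv = (k.centralBinom : ℚ) / 16 ^ k := by
  rw [thetaDeriv, coeff_derivative, thetaSeries, coeff_mk, if_neg (by simp), uCoeff]
  have h : (2 * k + 1) / 2 = k := by omega
  rw [h, pow_mul]
  push_cast
  have : (2 * (k : ℚ) + 1) ≠ 0 := by positivity
  field_simp
  norm_num

/-- This is `(4 - X²) y' = X y` for `y = θ'`; on coefficients it is the two-term recurrence of the
central binomial coefficients. -/
theorem thetaDeriv_ode :
    4 * derivative ℚ thetaDeriv = X * (X * derivative ℚ thetaDeriv) + X * thetaDeriv := by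
  have h4 : (4 : PowerSeries ℚ) = C 4 := (map_ofNat C 4).symm
  ext n
  rw [h4, map_add, coeff_C_mul]
  rcases n with _ | n
  · simp [coeff_derivative, coeff_thetaDeriv_odd 0, coeff_zero_eq_constantCoeff]
  · rw [coeff_succ_X_mul, coeff_succ_X_mul]
    have h2 : coeff n (X * derivative ℚ thetaDeriv) = n * coeff n thetaDeriv := by
      rcases n with _ | n
      · simp
      · rw [coeff_succ_X_mul, coeff_derivative]
        push_cast
        ring
    rw [h2, coeff_derivative]
    obtain ⟨k, rfl | rfl⟩ := Nat.even_or_odd' n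
    · rw [show 2 * k + 1 + 1 = 2 * (k + 1) by ring, coeff_thetaDeriv_even, coeff_thetaDeriv_even]
      have hc : ((k : ℚ) + 1) * ((k + 1).centralBinom : ℚ) = 2 * (2 * k + 1) * k.centralBinom := by
        exact_mod_cast Nat.succ_mul_centralBinom_succ k
      push_cast
      rw [pow_succ]
      field_simp
      linear_combination 8 * hc
    · rw [show 2 * k + 1 + 1 + 1 = 2 * (k + 1) + 1 by ring, coeff_thetaDeriv_odd,
        coeff_thetaDeriv_odd]
      simp

theorem constantCoeff_thetaDeriv : constantCoeff thetaDeriv = 1 := by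
  have := coeff_thetaDeriv_even 0
  simpa using this

theorem constantCoeff_thetaSeries : constantCoeff thetaSeries = 0 := by
  rw [← coeff_zero_eq_constantCoeff_apply, thetaSeries, coeff_mk, if_pos (by simp)]

theorem thetaDeriv_mul_cosHalfTheta : thetaDeriv * cosHalfTheta = 1 :=
  PowerSeries.mul_inv_cancel _ (by rw [constantCoeff_thetaDeriv]; exact one_ne_zero)

/-- By the differential equation the left side has derivative zero, so it equals its constant term.
This makes `thetaDeriv` an inverse square root without introducing fractional powers. -/
theorem four_sub_mul_thetaDeriv_sq : (4 - X ^ 2) * thetaDeriv ^ 2 = 4 := by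
  apply derivative.ext
  · have h4 : (4 : PowerSeries ℚ) = C 4 := (map_ofNat C 4).symm
    rw [Derivation.leibniz, map_sub, h4, derivative_C, ← h4, derivative_pow, derivative_pow,
      derivative_X]
    simp only [smul_eq_mul]
    push_cast
    linear_combination 2 * thetaDeriv * thetaDeriv_ode
  · have : constantCoeff (4 : PowerSeries ℚ) = 4 := map_ofNat constantCoeff 4
    simp [constantCoeff_thetaDeriv, this]

theorem four_mul_cosHalfTheta_sq : 4 * cosHalfTheta ^ 2 = 4 - X ^ 2 := by
  have h1 := thetaDeriv_mul_cosHalfTheta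
  linear_combination -cosHalfTheta ^ 2 * four_sub_mul_thetaDeriv_sq +
    (4 - X ^ 2) * (thetaDeriv * cosHalfTheta + 1) * h1

theorem four_mul_derivative_cosHalfTheta :
    4 * derivative ℚ cosHalfTheta = -(X * thetaDeriv) := by
  have h1 := thetaDeriv_mul_cosHalfTheta
  have h2 := four_mul_cosHalfTheta_sq
  have h3 := congrArg (derivative ℚ) h1
  rw [Derivation.leibniz, derivative_one] at h3
  simp only [smul_eq_mul] at h3
  -- `y r' = -r y'` and `(4 - X ^ 2) y' = X y`
  have h4 : 4 * derivative ℚ cosHalfTheta = -(4 * cosHalfTheta ^ 2) * derivative ℚ thetaDeriv := by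
    linear_combination 4 * cosHalfTheta * h3 - 4 * derivative ℚ cosHalfTheta * h1
  rw [h4, h2]
  linear_combination -thetaDeriv_ode

theorem constantCoeff_cosHalfTheta : constantCoeff cosHalfTheta = 1 := by
  rw [cosHalfTheta, constantCoeff_inv, constantCoeff_thetaDeriv, inv_one]

theorem wPlus_succ (k : ℕ) :
    4 * ((2 * k + 3 : ℕ) : ℚ) * wPlus (2 * k + 3) = (2 * k + 2 : ℕ) * wPlus (2 * k + 1) := by
  have h1 : (2 * k + 3) / 2 = k + 1 := by omega
  have h2 : (2 * k + 1) / 2 = k := by omega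
  rw [wPlus, wPlus, h1, h2, Nat.factorial_succ k, Nat.factorial_succ (2 * k + 2),
    Nat.factorial_succ (2 * k + 1)]
  have := Nat.factorial_ne_zero (2 * k + 1)
  push_cast
  field_simp
  ring

theorem wMinus_succ (k : ℕ) :
    4 * ((2 * k + 3 : ℕ) : ℚ) * wMinus (2 * k + 3) = -wPlus (2 * k + 1) := by
  have h1 : (2 * k + 3) / 2 = k + 1 := by omega
  have h2 : (2 * k + 1) / 2 = k := by omega
  rw [wPlus, wMinus, if_neg (by omega), h1, h2, Nat.factorial_succ k, Nat.factorial_succ (2 * k + 2),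
    Nat.factorial_succ (2 * k + 1)]
  have := Nat.factorial_ne_zero (2 * k + 1)
  push_cast
  field_simp
  ring

theorem coeff_wPlusSeries_even (k : ℕ) : coeff (2 * k) wPlusSeries = 0 := by
  simp [wPlusSeries]

theorem coeff_wPlusSeries_odd (k : ℕ) : coeff (2 * k + 1) wPlusSeries = wPlus (2 * k + 1) := by
  simp [wPlusSeries]

theorem coeff_wMinusSeries_odd (k : ℕ) : coeff (2 * k + 1) wMinusSeries = wMinus (2 * k + 1) := by
  simp [wMinusSeries]

/-- The ratio of consecutive `w₊` weights, written as `(4 - X²) W₊' = 4 + X W₊`. The same equation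
with the same constant term is satisfied by `θ / cos (θ/2)`. -/
theorem wPlusSeries_ode :
    4 * derivative ℚ wPlusSeries =
      4 + (X * (X * derivative ℚ wPlusSeries) + X * wPlusSeries) := by
  have h4 : (4 : PowerSeries ℚ) = C 4 := (map_ofNat C 4).symm
  ext n
  rw [h4, map_add, map_add, coeff_C_mul, coeff_C, coeff_derivative]
  rcases n with _ | n
  · have := coeff_wPlusSeries_odd 0
    simp only [mul_zero, zero_add] at this
    simp [this, wPlus]
  · rw [coeff_succ_X_mul, coeff_succ_X_mul]
    have h2 : coeff n (X * derivative ℚ wPlusSeries) = n * coeff n wPlusSeries := by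
      rcases n with _ | n
      · simp
      · rw [coeff_succ_X_mul, coeff_derivative]
        push_cast
        ring
    rw [h2]
    obtain ⟨k, rfl | rfl⟩ := Nat.even_or_odd' n
    · rw [show 2 * k + 1 + 1 = 2 * (k + 1) by ring, coeff_wPlusSeries_even, coeff_wPlusSeries_even]
      simp
    · rw [show 2 * k + 1 + 1 + 1 = 2 * (k + 1) + 1 by ring, coeff_wPlusSeries_odd,
        coeff_wPlusSeries_odd]
      have := wPlus_succ k
      push_cast at this ⊢
      rw [show 2 * (k + 1) + 1 = 2 * k + 3 by ring]
      linear_combination this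

theorem four_mul_derivative_wMinusSeries :
    4 * derivative ℚ wMinusSeries = 4 - X * wPlusSeries := by
  have h4 : (4 : PowerSeries ℚ) = C 4 := (map_ofNat C 4).symm
  ext n
  rw [h4, map_sub, coeff_C_mul, coeff_C, coeff_derivative]
  rcases n with _ | n
  · have := coeff_wMinusSeries_odd 0
    simp only [mul_zero, zero_add] at this
    simp [this, wMinus]
  · rw [coeff_succ_X_mul]
    obtain ⟨k, rfl | rfl⟩ := Nat.even_or_odd' n
    · rw [show 2 * k + 1 + 1 = 2 * (k + 1) by ring, coeff_wPlusSeries_even]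
      simp [wMinusSeries]
    · rw [show 2 * k + 1 + 1 + 1 = 2 * (k + 1) + 1 by ring, coeff_wMinusSeries_odd,
        coeff_wPlusSeries_odd]
      have := wMinus_succ k
      push_cast at this ⊢
      rw [show 2 * (k + 1) + 1 = 2 * k + 3 by ring]
      linear_combination this

/-- Both sides vanish at `0`, and their derivatives agree by the differential equations of the two
factors. -/
theorem wPlusSeries_mul_cosHalfTheta : wPlusSeries * cosHalfTheta = thetaSeries := by
  apply derivative.ext
  · rw [Derivation.leibniz]
    simp only [smul_eq_mul]
    change _ = thetaDeriv
    have h : (4 : PowerSeries ℚ) ≠ 0 := by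
      intro h
      simpa using (map_ofNat (constantCoeff (R := ℚ)) 4).symm.trans (congrArg constantCoeff h)
    apply mul_left_cancel₀ h
    have h1 := thetaDeriv_mul_cosHalfTheta
    linear_combination wPlusSeries * four_mul_derivative_cosHalfTheta + thetaDeriv * wPlusSeries_ode
      - 4 * cosHalfTheta * derivative ℚ wPlusSeries * h1
      + thetaDeriv * derivative ℚ wPlusSeries * four_mul_cosHalfTheta_sq
  · have : constantCoeff wPlusSeries = 0 := by
      simpa using coeff_wPlusSeries_even 0
    simp [this, constantCoeff_thetaSeries]

theorem wMinusSeries_eq : wMinusSeries = thetaSeries * cosHalfTheta := by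
  apply derivative.ext
  · rw [Derivation.leibniz]
    simp only [smul_eq_mul]
    change _ = _ + _ * thetaDeriv
    have h : (4 : PowerSeries ℚ) ≠ 0 := by
      intro h
      simpa using (map_ofNat (constantCoeff (R := ℚ)) 4).symm.trans (congrArg constantCoeff h)
    apply mul_left_cancel₀ h
    have h1 := thetaDeriv_mul_cosHalfTheta
    rw [← wPlusSeries_mul_cosHalfTheta]
    linear_combination four_mul_derivative_wMinusSeries - wPlusSeries * cosHalfTheta *
      four_mul_derivative_cosHalfTheta + (X * wPlusSeries - 4) * h1
  · have : constantCoeff wMinusSeries = 0 := by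
      rw [← coeff_zero_eq_constantCoeff_apply, wMinusSeries, coeff_mk, if_pos (by simp)]
    simp [this, constantCoeff_thetaSeries]

/-- The cosines in `W₋ = θ c` and `W₊ = θ / c` cancel, so an adjacent pair of blocks of opposite
kinds contributes just `θ²`. -/
theorem wMinusSeries_mul_wPlusSeries : wMinusSeries * wPlusSeries = thetaSeries ^ 2 := by
  rw [wMinusSeries_eq]
  linear_combination thetaSeries * wPlusSeries_mul_cosHalfTheta

/-! #### Parity -/

/-- Parity is expressed through `X ↦ -X`, a ring homomorphism, so that it passes to products and
powers at once. -/
theorem coeff_eq_zero_of_rescale {f : PowerSeries ℚ} {k : ℕ} (hf : rescale (-1) f = (-1) ^ k * f)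
    {n : ℕ} (hn : n % 2 ≠ k % 2) : coeff n f = 0 := by
  have h := congrArg (coeff n) hf
  have hC : ((-1 : PowerSeries ℚ)) ^ k = C ((-1 : ℚ) ^ k) := by simp
  rw [hC, coeff_C_mul, coeff_rescale] at h
  rcases Nat.even_or_odd n with he | ho <;> rcases Nat.even_or_odd k with he' | ho'
  · rw [Nat.even_iff] at he he'; omega
  · rw [he.neg_one_pow, ho'.neg_one_pow] at h; linarith
  · rw [ho.neg_one_pow, he'.neg_one_pow] at h; linarith
  · rw [Nat.odd_iff] at ho ho'; omega

theorem rescale_neg_one_of_coeff_even {f : PowerSeries ℚ} (hf : ∀ n, Even n → coeff n f = 0) :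
    rescale (-1) f = -f := by
  ext n
  rw [coeff_rescale, map_neg]
  rcases Nat.even_or_odd n with he | ho
  · rw [hf n he]; simp
  · rw [ho.neg_one_pow]; ring

theorem rescale_thetaSeries : rescale (-1) thetaSeries = -thetaSeries :=
  rescale_neg_one_of_coeff_even fun n hn => by simp [thetaSeries, hn]

theorem rescale_wPlusSeries : rescale (-1) wPlusSeries = -wPlusSeries :=
  rescale_neg_one_of_coeff_even fun n hn => by simp [wPlusSeries, hn]

theorem rescale_wMinusSeries : rescale (-1) wMinusSeries = -wMinusSeries :=
  rescale_neg_one_of_coeff_even fun n hn => by simp [wMinusSeries, hn]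

theorem wPlusSeries_ne_zero : wPlusSeries ≠ 0 := by
  intro h
  have := coeff_wPlusSeries_odd 0
  rw [h] at this
  simp [wPlus] at this

/-- In `W₊ c = θ` both `W₊` and `θ` are odd; cancelling `W₊` leaves `c` even. -/
theorem rescale_cosHalfTheta : rescale (-1) cosHalfTheta = cosHalfTheta := by
  have h := congrArg (rescale (-1 : ℚ)) wPlusSeries_mul_cosHalfTheta
  rw [map_mul, rescale_wPlusSeries, rescale_thetaSeries, ← wPlusSeries_mul_cosHalfTheta,
    neg_mul, neg_inj] at h
  exact mul_left_cancel₀ wPlusSeries_ne_zero h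

theorem coeff_cosHalfTheta_mul_pow_eq_zero {n k : ℕ} (h : n % 2 ≠ k % 2) :
    coeff n (cosHalfTheta * thetaSeries ^ k) = 0 := by
  refine coeff_eq_zero_of_rescale (k := k) ?_ h
  rw [map_mul, map_pow, rescale_cosHalfTheta, rescale_thetaSeries, neg_pow]
  ring

theorem X_dvd_thetaSeries : X ∣ thetaSeries := X_dvd_iff.mpr constantCoeff_thetaSeries

theorem coeff_cosHalfTheta_mul_pow_of_lt {n k : ℕ} (h : n < k) :
    coeff n (cosHalfTheta * thetaSeries ^ k) = 0 := by
  have : X ^ k ∣ cosHalfTheta * thetaSeries ^ k :=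
    Dvd.dvd.mul_left (pow_dvd_pow_of_dvd X_dvd_thetaSeries k) _
  exact X_pow_dvd_iff.mp this n h

theorem coeff_cosHalfTheta_mul_pow_self (n : ℕ) :
    coeff n (cosHalfTheta * thetaSeries ^ n) = 1 := by
  obtain ⟨q, hq⟩ := X_dvd_thetaSeries
  have hq0 : constantCoeff q = 1 := by
    have h := congrArg (coeff 1) hq
    rw [show (1 : ℕ) = 0 + 1 from rfl, coeff_succ_X_mul] at h
    rw [← coeff_zero_eq_constantCoeff_apply, ← h]
    simp [thetaSeries, uCoeff]
  rw [hq, mul_pow, mul_left_comm, coeff_X_pow_mul', if_pos le_rfl, Nat.sub_self]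
  simp [constantCoeff_cosHalfTheta, hq0]

end SeriesIdentities

/-! ### Exponentials of `θ` and the closed form of the zigzag generating function -/

section ComplexSeries

open PowerSeries

/-- The power series `2 arcsin (z / 2)` with complex coefficients. -/
noncomputable def thetaComplex : PowerSeries ℂ := PowerSeries.map (algebraMap ℚ ℂ) thetaSeries

/-- The power series `(1 - z ^ 2 / 4) ^ (1 / 2)` with complex coefficients. -/
noncomputable def cosHalfThetaComplex : PowerSeries ℂ :=
  PowerSeries.map (algebraMap ℚ ℂ) cosHalfTheta

theorem constantCoeff_thetaComplex : constantCoeff thetaComplex = 0 := by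
  rw [thetaComplex, ← coeff_zero_eq_constantCoeff_apply, coeff_map,
    coeff_zero_eq_constantCoeff_apply, constantCoeff_thetaSeries, map_zero]

theorem hasSubst_thetaComplex : HasSubst thetaComplex :=
  HasSubst.of_constantCoeff_zero' constantCoeff_thetaComplex

/-- The substitution `f(x) ↦ f(a θ)`, where `θ = 2 arcsin (z / 2)`. -/
noncomputable def substTheta (a : ℂ) : PowerSeries ℂ →ₐ[ℂ] PowerSeries ℂ :=
  (substAlgHom hasSubst_thetaComplex).comp (rescaleAlgHom a)

theorem substTheta_apply (a : ℂ) (f : PowerSeries ℂ) :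
    substTheta a f = (rescale a f).subst thetaComplex := by
  rw [substTheta, AlgHom.comp_apply, coe_substAlgHom]
  exact congrArg (subst thetaComplex) (RingHom.congr_fun (coe_rescaleAlgHom a) f)

theorem coeff_thetaComplex_pow_of_lt {n k : ℕ} (h : n < k) : coeff n (thetaComplex ^ k) = 0 :=
  X_pow_dvd_iff.mp (pow_dvd_pow_of_dvd (X_dvd_iff.mpr constantCoeff_thetaComplex) k) n h

/-- Since `θ^k` is divisible by `X^k`, only `k ≤ n` contributes. Each coefficient is thus a
polynomial in the parameter `a`, which is what later yields a polynomial in `t`. -/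
theorem coeff_mul_substTheta (g : PowerSeries ℂ) (a : ℂ) (f : PowerSeries ℂ) (n : ℕ) :
    coeff n (g * substTheta a f) =
      ∑ k ∈ Finset.range (n + 1), coeff k f * a ^ k * coeff n (g * thetaComplex ^ k) := by
  have h (m : ℕ) (hm : m ≤ n) : coeff m (substTheta a f) =
      ∑ k ∈ Finset.range (n + 1), coeff k f * a ^ k * coeff m (thetaComplex ^ k) := by
    rw [substTheta_apply, coeff_subst' hasSubst_thetaComplex,
      finsum_eq_sum_of_support_subset (s := Finset.range (n + 1))]
    · refine Finset.sum_congr rfl fun k _ => ?_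
      rw [coeff_rescale, smul_eq_mul, mul_comm (a ^ k)]
    · intro k hk
      simp only [Finset.coe_range, Set.mem_Iio]
      by_contra hlt
      apply hk
      simp only [smul_eq_mul]
      rw [coeff_thetaComplex_pow_of_lt (by omega), mul_zero]
  rw [coeff_mul]
  simp_rw [coeff_mul, Finset.mul_sum]
  rw [Finset.sum_comm]
  refine Finset.sum_congr rfl fun p hp => ?_
  rw [h p.2 (by have := Finset.HasAntidiagonal.mem_antidiagonal.mp hp; omega), Finset.mul_sum]
  refine Finset.sum_congr rfl fun k _ => ?_
  ring

/-- The power series `exp (a θ)`, where `θ = 2 arcsin (z / 2)`. -/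
noncomputable def expTheta (a : ℂ) : PowerSeries ℂ := substTheta a (exp ℂ)

theorem expTheta_mul (a b : ℂ) : expTheta a * expTheta b = expTheta (a + b) := by
  simp only [expTheta, substTheta_apply]
  rw [← subst_mul hasSubst_thetaComplex, exp_mul_exp_eq_exp_add]

theorem expTheta_zero : expTheta 0 = 1 := by
  have h : rescale (0 : ℂ) (exp ℂ) = 1 := by
    rw [rescale_zero_apply, constantCoeff_exp, map_one]
  rw [expTheta, substTheta_apply, h, ← coe_substAlgHom hasSubst_thetaComplex, map_one]

theorem derivative_rescale_exp (a : ℂ) :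
    derivative ℂ (rescale a (exp ℂ)) = C a * rescale a (exp ℂ) := by
  ext n
  rw [coeff_derivative, coeff_C_mul, coeff_rescale, coeff_rescale, coeff_exp, coeff_exp,
    Nat.factorial_succ]
  have := Nat.factorial_ne_zero n
  have h : (n : ℂ) + 1 ≠ 0 := by exact_mod_cast Nat.succ_ne_zero n
  simp
  field_simp
  ring

theorem derivative_expTheta (a : ℂ) :
    derivative ℂ (expTheta a) = C a * expTheta a * derivative ℂ thetaComplex := by
  rw [expTheta, substTheta_apply, derivative_subst hasSubst_thetaComplex, derivative_rescale_exp,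
    subst_mul hasSubst_thetaComplex]
  congr 2
  rw [← coe_substAlgHom hasSubst_thetaComplex]
  exact (substAlgHom hasSubst_thetaComplex).commutes a

theorem constantCoeff_expTheta (a : ℂ) : constantCoeff (expTheta a) = 1 := by
  have h := coeff_mul_substTheta 1 a (exp ℂ) 0
  simpa [expTheta] using h

theorem derivative_map_algebraMap (f : PowerSeries ℚ) :
    derivative ℂ (PowerSeries.map (algebraMap ℚ ℂ) f) =
      PowerSeries.map (algebraMap ℚ ℂ) (derivative ℚ f) := by
  ext n
  simp [coeff_derivative]

theorem derivative_thetaComplex_mul :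
    derivative ℂ thetaComplex * cosHalfThetaComplex = 1 := by
  rw [thetaComplex, derivative_map_algebraMap, cosHalfThetaComplex, ← map_mul]
  exact (congrArg _ thetaDeriv_mul_cosHalfTheta).trans (map_one _)

theorem four_mul_derivative_cosHalfThetaComplex :
    4 * derivative ℂ cosHalfThetaComplex = -(X * derivative ℂ thetaComplex) := by
  have h := congrArg (PowerSeries.map (algebraMap ℚ ℂ)) four_mul_derivative_cosHalfTheta
  rw [map_mul, map_ofNat, map_neg, map_mul, map_X] at h
  rw [thetaComplex, derivative_map_algebraMap, cosHalfThetaComplex, derivative_map_algebraMap]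
  exact h

theorem constantCoeff_cosHalfThetaComplex : constantCoeff cosHalfThetaComplex = 1 := by
  rw [cosHalfThetaComplex, ← coeff_zero_eq_constantCoeff_apply, coeff_map,
    coeff_zero_eq_constantCoeff_apply, constantCoeff_cosHalfTheta, map_one]

theorem two_mul_C_half : (2 : PowerSeries ℂ) * C (1 / 2) = 1 := by
  rw [← map_ofNat C 2, ← map_mul]
  norm_num

/-- Euler's formula `exp (jθ/2) = cos (θ/2) + j sin (θ/2)` with `sin (θ/2) = X/2`. It is used for
both square roots `j = ±i` of `-1`. -/
theorem expTheta_eq_of_sq {j : ℂ} (hj : j ^ 2 = -1) :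
    expTheta (j / 2) = cosHalfThetaComplex + C (j / 2) * X := by
  -- The product has derivative zero: `θ' c = 1` and `4 c' = -X θ'` cancel all terms.
  have key : expTheta (-(j / 2)) * (cosHalfThetaComplex + C (j / 2) * X) = 1 := by
    apply derivative.ext
    · rw [Derivation.leibniz, derivative_expTheta, map_add, Derivation.leibniz, derivative_C,
        derivative_one, derivative_X]
      simp only [smul_eq_mul]
      have h4 : (4 : PowerSeries ℂ) ≠ 0 := by
        intro h
        simpa using (map_ofNat (constantCoeff (R := ℂ)) 4).symm.trans (congrArg constantCoeff h)
      apply mul_left_cancel₀ h4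
      have hC : 4 * (C (j / 2)) ^ 2 = (-1 : PowerSeries ℂ) := by
        rw [← map_pow, ← map_ofNat C 4, ← map_mul, div_pow, hj, ← map_one C, ← map_neg C]
        norm_num
      have h1 := derivative_thetaComplex_mul
      have h2 := four_mul_derivative_cosHalfThetaComplex
      rw [map_neg]
      linear_combination expTheta (-(j / 2)) * h2
        - 4 * C (j / 2) * expTheta (-(j / 2)) * h1
        - expTheta (-(j / 2)) * X * derivative ℂ thetaComplex * hC
    · simp [constantCoeff_expTheta, constantCoeff_cosHalfThetaComplex]
  have h := expTheta_mul (j / 2) (-(j / 2))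
  rw [add_neg_cancel, expTheta_zero] at h
  linear_combination (cosHalfThetaComplex + C (j / 2) * X) * h - expTheta (j / 2) * key

/-! #### Trigonometric series -/

/-- The power series `2 cos (m θ / 2)`. -/
noncomputable def cosTheta (m : ℤ) : PowerSeries ℂ :=
  expTheta (Complex.I * m / 2) + expTheta (-(Complex.I * m / 2))

/-- The power series `2 sin (m θ / 2)`. -/
noncomputable def sinTheta (m : ℤ) : PowerSeries ℂ :=
  -C Complex.I * (expTheta (Complex.I * m / 2) - expTheta (-(Complex.I * m / 2)))

theorem C_I_sq : (C Complex.I : PowerSeries ℂ) ^ 2 = -1 := by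
  rw [← map_pow, Complex.I_sq, map_neg, map_one]

theorem cosTheta_one : cosTheta 1 = 2 * cosHalfThetaComplex := by
  have h1 := expTheta_eq_of_sq Complex.I_sq
  have h2 := expTheta_eq_of_sq (j := -Complex.I) (by rw [neg_sq, Complex.I_sq])
  rw [cosTheta, Int.cast_one, mul_one, h1, ← neg_div, h2, neg_div, map_neg]
  ring

theorem sinTheta_one : sinTheta 1 = X := by
  have h1 := expTheta_eq_of_sq Complex.I_sq
  have h2 := expTheta_eq_of_sq (j := -Complex.I) (by rw [neg_sq, Complex.I_sq])
  rw [sinTheta, Int.cast_one, mul_one, h1, ← neg_div, h2, neg_div, map_neg]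
  have h3 : (C (Complex.I / 2) : PowerSeries ℂ) = C Complex.I * C (1 / 2) := by
    rw [← map_mul]; congr 1; ring
  rw [h3]
  linear_combination -2 * C (1 / 2) * X * C_I_sq + X * two_mul_C_half

theorem sinTheta_neg (m : ℤ) : sinTheta (-m) = -sinTheta m := by
  rw [sinTheta, sinTheta]
  push_cast
  rw [mul_neg, neg_div, neg_neg]
  ring

theorem cosTheta_neg (m : ℤ) : cosTheta (-m) = cosTheta m := by
  rw [cosTheta, cosTheta]
  push_cast
  rw [mul_neg, neg_div, neg_neg]
  ring

theorem sinTheta_zero : sinTheta 0 = 0 := by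
  simp [sinTheta]

theorem sinTheta_mul_cosTheta (l m : ℤ) :
    sinTheta l * cosTheta m = sinTheta (l + m) + sinTheta (l - m) := by
  simp only [sinTheta, cosTheta]
  have h1 := expTheta_mul (Complex.I * l / 2) (Complex.I * m / 2)
  have h2 := expTheta_mul (Complex.I * l / 2) (-(Complex.I * m / 2))
  have h3 := expTheta_mul (-(Complex.I * l / 2)) (Complex.I * m / 2)
  have h4 := expTheta_mul (-(Complex.I * l / 2)) (-(Complex.I * m / 2))
  have e1 : Complex.I * (l + m : ℤ) / 2 = Complex.I * l / 2 + Complex.I * m / 2 := by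
    push_cast; ring
  have e2 : Complex.I * (l - m : ℤ) / 2 = Complex.I * l / 2 + -(Complex.I * m / 2) := by
    push_cast; ring
  rw [e1, e2, neg_add, neg_add, neg_neg, ← h1, ← h2, ← h3, ← h4]
  ring

theorem sinTheta_mul_sinTheta (l m : ℤ) :
    sinTheta l * sinTheta m = cosTheta (l - m) - cosTheta (l + m) := by
  simp only [sinTheta, cosTheta]
  have h1 := expTheta_mul (Complex.I * l / 2) (Complex.I * m / 2)
  have h2 := expTheta_mul (Complex.I * l / 2) (-(Complex.I * m / 2))
  have h3 := expTheta_mul (-(Complex.I * l / 2)) (Complex.I * m / 2)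
  have h4 := expTheta_mul (-(Complex.I * l / 2)) (-(Complex.I * m / 2))
  have e1 : Complex.I * (l + m : ℤ) / 2 = Complex.I * l / 2 + Complex.I * m / 2 := by
    push_cast; ring
  have e2 : Complex.I * (l - m : ℤ) / 2 = Complex.I * l / 2 + -(Complex.I * m / 2) := by
    push_cast; ring
  rw [e1, e2, neg_add, neg_add, neg_neg, ← h1, ← h2, ← h3, ← h4]
  linear_combination (expTheta (Complex.I * l / 2) - expTheta (-(Complex.I * l / 2))) *
    (expTheta (Complex.I * m / 2) - expTheta (-(Complex.I * m / 2))) * C_I_sq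

theorem constantCoeff_cosTheta (m : ℤ) : constantCoeff (cosTheta m) = 2 := by
  simp [cosTheta, constantCoeff_expTheta]
  norm_num

theorem cosTheta_mul_inv (m : ℤ) : cosTheta m * (cosTheta m)⁻¹ = 1 :=
  PowerSeries.mul_inv_cancel _ (by rw [constantCoeff_cosTheta]; exact two_ne_zero)

/-- The power series `sec x + tan x`. -/
noncomputable def secAddTan : PowerSeries ℂ :=
  (1 - C Complex.I * rescale Complex.I (exp ℂ)) * (rescale Complex.I (exp ℂ) - C Complex.I)⁻¹

/-- With `q = exp (ix)`, cancelling the common factor `q + i` in `(1 + sin x) / cos x` leaves `(1 -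
iq) / (q - i)`. Unlike `q² + 1` over powers of `q`, this needs a single exponential; the denominator
is invertible because its constant term is `1 - i`. -/
theorem secAddTan_mul :
    secAddTan * (rescale Complex.I (exp ℂ) - C Complex.I) =
      1 - C Complex.I * rescale Complex.I (exp ℂ) := by
  rw [secAddTan, mul_assoc, PowerSeries.inv_mul_cancel, mul_one]
  rw [map_sub, constantCoeff_C, ← coeff_zero_eq_constantCoeff_apply, coeff_rescale]
  intro h
  have := congrArg Complex.im h
  simp at this

theorem substTheta_rescale_exp (a b : ℂ) :
    substTheta a (rescale b (exp ℂ)) = expTheta (b * a) := by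
  rw [expTheta, substTheta_apply, substTheta_apply, rescale_rescale]

theorem substTheta_C (a b : ℂ) : substTheta a (C b) = C b :=
  (substTheta a).commutes b

theorem substTheta_secAddTan_mul (m : ℤ) :
    substTheta (m / 2) secAddTan * cosTheta m = 2 + sinTheta m := by
  have h := congrArg (substTheta ((m : ℂ) / 2)) secAddTan_mul
  rw [map_mul, map_sub, map_sub, map_mul, substTheta_rescale_exp, substTheta_C, map_one,
    ← mul_div_assoc] at h
  have h1 := expTheta_mul (Complex.I * m / 2) (-(Complex.I * m / 2))
  rw [add_neg_cancel, expTheta_zero] at h1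
  rw [cosTheta, sinTheta]
  set q := expTheta (Complex.I * m / 2)
  set p := expTheta (-(Complex.I * m / 2))
  -- Multiplying by `(q + i) p` restores the cancelled factor: `(q - i)(q + i) p = q + p` because `q
  -- p = 1`.
  linear_combination (q + C Complex.I) * p * h + (1 - C Complex.I * q) * h1 + h1
    - substTheta (m / 2) secAddTan * q * h1 + substTheta (m / 2) secAddTan * p * C_I_sq
    - q * p * C_I_sq

/-! #### The zigzag generating functions -/

/-- The generating function for the order-preserving maps from zigzags to a chain with `s` elements
such that the first value is one of the `v` largest ones. -/
noncomputable def zigzagSeries (s v : ℕ) : PowerSeries ℂ :=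
  (cosTheta (2 * s + 1 - 2 * v) + sinTheta (2 * v)) * (cosTheta (2 * s + 1))⁻¹

theorem zigzagSeries_zero (s : ℕ) : zigzagSeries s 0 = 1 := by
  simp [zigzagSeries, sinTheta_zero, cosTheta_mul_inv]

/-- Writing `X` as `2 sin (θ/2)`, the product-to-sum formulas express `X` times each numerator term
as a difference; the differences telescope to the change from `v` to `v + 1`. -/
theorem zigzagSeries_succ {s v : ℕ} (h : v ≤ s) :
    zigzagSeries s (v + 1) = zigzagSeries s v + X * zigzagSeries s (s - v) := by
  simp only [zigzagSeries]
  rw [← sinTheta_one]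
  push_cast [h]
  have h1 := sinTheta_mul_cosTheta 1 (2 * v + 1)
  have h2 := sinTheta_mul_sinTheta 1 (2 * s - 2 * v)
  rw [show (1 : ℤ) + (2 * v + 1) = 2 * (v + 1) by ring,
    show (1 : ℤ) - (2 * v + 1) = -(2 * v) by ring, sinTheta_neg] at h1
  rw [show (1 : ℤ) + (2 * s - 2 * v) = 2 * s + 1 - 2 * v by ring, ← cosTheta_neg (1 - _),
    show -((1 : ℤ) - (2 * s - 2 * v)) = 2 * s + 1 - 2 * (v + 1) by ring] at h2
  rw [show (2 : ℤ) * s + 1 - 2 * (s - v) = 2 * v + 1 by ring,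
    show (2 : ℤ) * (s - v) = 2 * s - 2 * v by ring]
  linear_combination -(cosTheta (2 * s + 1))⁻¹ * (h1 + h2)

/-- The numerator is `cos (θ/2) + sin (sθ)`. Expanding `sin (sθ)` as `sin ((s + 1/2)θ - θ/2)`
produces `cos (θ/2) (1 + sin ((s + 1/2)θ))` minus `sin (θ/2) cos ((s + 1/2)θ)`; after division the
last term is `X/2`. -/
theorem two_mul_zigzagSeries_self (s : ℕ) :
    2 * zigzagSeries s s =
      2 * (cosHalfThetaComplex * substTheta ((s : ℂ) + 1 / 2) secAddTan) - X := by
  have h1 := substTheta_secAddTan_mul (2 * s + 1)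
  rw [show (((2 * s + 1 : ℤ) : ℂ) / 2) = (s : ℂ) + 1 / 2 by push_cast; ring] at h1
  have h2 := sinTheta_mul_cosTheta (2 * s + 1) 1
  have h3 := sinTheta_mul_cosTheta 1 (2 * s + 1)
  rw [show (2 * s + 1 : ℤ) + 1 = 1 + (2 * s + 1) by ring,
    show (2 * s + 1 : ℤ) - 1 = 2 * s by ring] at h2
  rw [show (1 : ℤ) - (2 * s + 1) = -(2 * s) by ring, sinTheta_neg] at h3
  have h4 := cosTheta_mul_inv (2 * s + 1)
  rw [zigzagSeries, show (2 : ℤ) * s + 1 - 2 * s = 1 by ring]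
  rw [sinTheta_one] at h3
  rw [cosTheta_one] at h2 ⊢
  set u := (cosTheta (2 * s + 1))⁻¹
  set S := substTheta ((s : ℂ) + 1 / 2) secAddTan
  linear_combination u * (h3 - h2) - 2 * cosHalfThetaComplex * u * h1
    + (2 * cosHalfThetaComplex * S - X) * h4

end ComplexSeries

/-! ### Counting order-preserving maps from a zigzag by removing the first entry -/

section Counting

/-- The number of sequences `x_1 ≥ x_2 ≤ x_3 ≥ ⋯` of length `n` with values in a chain with `s`
elements whose first entry, if any, is one of the `v` largest values. -/
def zigzagCount (s : ℕ) : ℕ → ℕ → ℕ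
  | 0, _ => 1
  | n + 1, v => ∑ w ∈ Finset.range v, zigzagCount s n (s - w)

theorem zigzagSeries_eq_sum {s v : ℕ} (h : v ≤ s) :
    zigzagSeries s v = 1 + PowerSeries.X * ∑ w ∈ Finset.range v, zigzagSeries s (s - w) := by
  induction v with
  | zero => simp [zigzagSeries_zero]
  | succ v ih =>
    rw [zigzagSeries_succ (by omega), ih (by omega), Finset.sum_range_succ]
    ring

theorem coeff_zigzagSeries {s v : ℕ} (n : ℕ) (h : v ≤ s) :
    PowerSeries.coeff n (zigzagSeries s v) = zigzagCount s n v := by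
  induction n generalizing v with
  | zero => simp [zigzagSeries_eq_sum h, zigzagCount]
  | succ n ih =>
    rw [zigzagSeries_eq_sum h, map_add, PowerSeries.coeff_succ_X_mul, map_sum, zigzagCount]
    push_cast
    rw [PowerSeries.coeff_one, if_neg (by omega), zero_add]
    exact Finset.sum_congr rfl fun w _ => ih (by omega)

/-- The sequence satisfies `x_1 ≥ x_2 ≤ x_3 ≥ ⋯`. -/
def IsZigzagSeq {n s : ℕ} (f : Fin n → Fin s) : Prop :=
  ∀ (i : ℕ) (h : i + 1 < n), (Odd i → f ⟨i, by omega⟩ ≤ f ⟨i + 1, h⟩) ∧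
    (Even i → f ⟨i + 1, h⟩ ≤ f ⟨i, by omega⟩)

/-- The sequences `x_1 ≥ x_2 ≤ x_3 ≥ ⋯` of length `n` with values in `Fin s` whose first entry is
one of the `v` largest values. -/
def ZigzagSeq (s n v : ℕ) : Type :=
  {f : Fin n → Fin s // IsZigzagSeq f ∧ ∀ h : 0 < n, s ≤ f ⟨0, h⟩ + v}

instance (s n v : ℕ) : Finite (ZigzagSeq s n v) := inferInstanceAs (Finite (Subtype _))

/-- Deleting the first entry shifts the parity of the positions and so turns the zigzag upside down;
reversing the values restores its shape. -/
theorem isZigzagSeq_succ_iff {n s : ℕ} (f : Fin (n + 1) → Fin s) :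
    IsZigzagSeq f ↔ IsZigzagSeq (fun i : Fin n => (f i.succ).rev) ∧
      ∀ h : 0 < n, f (Fin.succ ⟨0, h⟩) ≤ f 0 := by
  constructor
  · intro hf
    refine ⟨fun i h => ?_, fun h => (hf 0 (by omega)).2 (by simp)⟩
    have h1 := hf (i + 1) (by omega)
    refine ⟨fun hi => ?_, fun hi => ?_⟩
    · exact Fin.rev_le_rev.mpr (h1.2 hi.add_one)
    · exact Fin.rev_le_rev.mpr (h1.1 hi.add_one)
  · rintro ⟨hf, h0⟩ i h
    rcases i with _ | i
    · exact ⟨fun hi => by simp at hi, fun _ => h0 (by omega)⟩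
    · have h1 := hf i (by omega)
      refine ⟨fun hi => ?_, fun hi => ?_⟩
      · exact Fin.rev_le_rev.mp (h1.2 (by simpa [Nat.odd_add_one] using hi))
      · exact Fin.rev_le_rev.mp (h1.1 (by simpa [Nat.even_add_one] using hi))

/-- Removing the first entry and reversing the values of the others. -/
def zigzagSeqSuccEquiv (s n v : ℕ) (hv : v ≤ s) :
    ZigzagSeq s (n + 1) v ≃ Σ w : Fin v, ZigzagSeq s n (s - w) where
  -- The index `w` counts the values above the first entry. A second entry at most the first
  -- becomes, after reversal, one of the `s - w` largest values.
  toFun f := ⟨⟨s - 1 - f.1 0, by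
      have h1 : s ≤ f.1 0 + v := f.2.2 (by omega)
      have h2 := (f.1 0).isLt
      omega⟩, fun i => (f.1 i.succ).rev, ((isZigzagSeq_succ_iff _).mp f.2.1).1, fun h => by
      have h1 : (f.1 (Fin.succ ⟨0, h⟩)).val ≤ (f.1 0).val := ((isZigzagSeq_succ_iff _).mp f.2.1).2 h
      have h2 := (f.1 0).isLt
      rw [Fin.val_rev]
      change s ≤ _ + (s - (s - 1 - (f.1 0).val))
      omega⟩
  invFun g := ⟨Fin.cons ⟨s - 1 - g.1, by have := g.1.isLt; omega⟩ fun i => (g.2.1 i).rev, by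
      rw [isZigzagSeq_succ_iff]
      refine ⟨by simpa using g.2.2.1, fun h => ?_⟩
      have h1 : s ≤ (g.2.1 ⟨0, h⟩).val + (s - g.1) := g.2.2.2 h
      have h2 := g.1.isLt
      rw [Fin.cons_succ, Fin.cons_zero, Fin.le_def, Fin.val_rev]
      change _ ≤ s - 1 - g.1.val
      omega, fun h => by
      have h2 := g.1.isLt
      change s ≤ s - 1 - g.1.val + v
      omega⟩
  left_inv f := by
    refine Subtype.ext (funext fun i => ?_)
    refine Fin.cases ?_ (fun i => ?_) i
    · refine Fin.ext ?_
      have h2 := (f.1 0).isLt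
      change s - 1 - (s - 1 - (f.1 0).val) = _
      omega
    · simp
  right_inv g := by
    refine Sigma.subtype_ext (Fin.ext ?_) (funext fun i => ?_)
    · have h2 := g.1.isLt
      change s - 1 - (s - 1 - g.1.val) = _
      omega
    · simp

theorem card_zigzagSeq (s n v : ℕ) (hv : v ≤ s) :
    Nat.card (ZigzagSeq s n v) = zigzagCount s n v := by
  induction n generalizing v with
  | zero =>
    rw [zigzagCount, Nat.card_eq_one_iff_unique]
    exact ⟨⟨fun f g => Subtype.ext (funext fun i => i.elim0)⟩,
      ⟨⟨fun i => i.elim0, fun i h => absurd h (by omega), fun h => absurd h (by omega)⟩⟩⟩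
  | succ n ih =>
    rw [Nat.card_congr (zigzagSeqSuccEquiv s n v hv), Nat.card_sigma, zigzagCount,
      ← Fin.sum_univ_eq_sum_range (fun w => zigzagCount s n (s - w))]
    exact Finset.sum_congr rfl fun w _ => ih _ (by omega)

/-- Order-preserving maps from a zigzag to a chain as sequences. -/
def orderHomEquivZigzagSeq (s n : ℕ) : (Zigzag n →o Fin s) ≃ ZigzagSeq s n s where
  toFun f := ⟨fun i => f i, fun i h =>
    ⟨fun hi => f.monotone (Or.inr ⟨hi, Or.inr rfl⟩),
      fun hi => f.monotone (Or.inr ⟨hi.add_one, Or.inl rfl⟩)⟩, fun h => by omega⟩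
  invFun f := ⟨f.1, by
    rintro x y (rfl | ⟨hx, hxy | hxy⟩)
    · exact le_rfl
    · have hy : Even y.idx := by
        rw [← hxy, Nat.odd_add_one, Nat.not_odd_iff_even] at hx
        exact hx
      have h1 := (f.2.1 y.idx (by rw [hxy]; exact x.isLt)).2 hy
      have h2 : (⟨y.idx + 1, by rw [hxy]; exact x.isLt⟩ : Fin n) = x := Fin.ext hxy
      rw [h2] at h1
      exact h1
    · have h1 := (f.2.1 x.idx (by rw [← hxy]; exact y.isLt)).1 hx
      have h2 : (⟨x.idx + 1, by rw [← hxy]; exact y.isLt⟩ : Fin n) = y := Fin.ext hxy.symm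
      rw [h2] at h1
      exact h1⟩
  left_inv _ := rfl
  right_inv _ := rfl

theorem card_zigzag_orderHom (n s : ℕ) : Nat.card (Zigzag n →o Fin s) = zigzagCount s n s := by
  rw [Nat.card_congr (orderHomEquivZigzagSeq s n), card_zigzagSeq s n s le_rfl]

end Counting

/-! ### Coefficients of the shifted order polynomial -/

section OrderPolynomialCoefficients

open Polynomial

theorem orderPolynomial_eq_sum (P : Type*) [PartialOrder P] [Finite P] :
    orderPolynomial P = ∑ k ∈ Finset.range (Nat.card P + 1),
      C ((surjCount P k : ℚ) / (k.factorial : ℚ)) * descPochhammer ℚ k := by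
  refine Polynomial.eq_of_infinite_eval_eq _ _ ?_
  refine (Set.infinite_range_of_injective (Nat.cast_injective (R := ℚ))).mono ?_
  rintro _ ⟨t, rfl⟩
  have hterm (k : ℕ) : (C ((surjCount P k : ℚ) / (k.factorial : ℚ)) * descPochhammer ℚ k).eval
      (t : ℚ) = ((t.choose k * surjCount P k : ℕ) : ℚ) := by
    rw [eval_mul, eval_C, descPochhammer_eval_eq_descFactorial,
      Nat.descFactorial_eq_factorial_mul_choose]
    have : (k.factorial : ℚ) ≠ 0 := by exact_mod_cast k.factorial_ne_zero
    push_cast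
    field_simp
  have hzero (k : ℕ) (hk : Nat.card P < k) : surjCount P k = 0 := by
    have : IsEmpty {f : P →o Fin k // Function.Surjective f} := by
      refine ⟨fun f => ?_⟩
      have := Nat.card_le_card_of_surjective _ f.2
      simp at this
      omega
    simp [surjCount]
  rw [Set.mem_ofPred_eq, orderPolynomial_eval, card_orderHom_fin, eval_finsetSum]
  simp_rw [hterm]
  rw [← Nat.cast_sum]
  congr 1
  have h1 : ∑ k ∈ Finset.range (t + 1), t.choose k * surjCount P k =
      ∑ k ∈ Finset.range (max t (Nat.card P) + 1), t.choose k * surjCount P k := by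
    refine Finset.sum_subset (Finset.range_mono (by omega)) fun k _ hk => ?_
    rw [Finset.mem_range] at hk
    rw [Nat.choose_eq_zero_of_lt (by omega), zero_mul]
  rw [h1]
  refine (Finset.sum_subset (Finset.range_mono (by omega)) fun k _ hk => ?_).symm
  rw [Finset.mem_range] at hk
  rw [hzero k (by omega), mul_zero]

theorem natDegree_orderPolynomial_le (P : Type*) [PartialOrder P] [Finite P] :
    (orderPolynomial P).natDegree ≤ Nat.card P := by
  rw [orderPolynomial_eq_sum]
  refine natDegree_sum_le_of_forall_le _ _ fun k hk => ?_
  refine (natDegree_C_mul_le _ _).trans ?_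
  rw [descPochhammer_natDegree]
  have := Finset.mem_range.mp hk
  omega

theorem coeff_orderPolynomial_card (P : Type*) [PartialOrder P] [Finite P] :
    (orderPolynomial P).coeff (Nat.card P) =
      (linearExtensionCount P : ℚ) / ((Nat.card P).factorial : ℚ) := by
  rw [orderPolynomial_eq_sum, finsetSum_coeff, Finset.sum_range_succ, Finset.sum_eq_zero, zero_add]
  · rw [coeff_C_mul]
    have h := (monic_descPochhammer ℚ (Nat.card P)).coeff_natDegree
    rw [descPochhammer_natDegree] at h
    rw [h, mul_one]
    rfl
  · intro k hk
    rw [coeff_C_mul, coeff_eq_zero_of_natDegree_lt, mul_zero]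
    rw [descPochhammer_natDegree]
    exact Finset.mem_range.mp hk

theorem coeff_taylor_of_natDegree_le {R : Type*} [CommRing R] {p : R[X]} {n : ℕ}
    (h : p.natDegree ≤ n) (r : R) : (taylor r p).coeff n = p.coeff n := by
  rcases h.eq_or_lt with rfl | h
  · exact coeff_taylor_natDegree r p
  · rw [coeff_eq_zero_of_natDegree_lt h, coeff_eq_zero_of_natDegree_lt (by rwa [natDegree_taylor])]

theorem natCard_zigzag (n : ℕ) : Nat.card (Zigzag n) = n := Nat.card_fin n

theorem coeff_shiftedZigzagPolynomial_self (n : ℕ) :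
    (shiftedZigzagPolynomial n).coeff n = (eulerZigzag n : ℚ) / (n.factorial : ℚ) := by
  have h1 := natDegree_orderPolynomial_le (Zigzag n)
  have h2 := coeff_orderPolynomial_card (Zigzag n)
  rw [natCard_zigzag] at h1 h2
  rw [shiftedZigzagPolynomial, sub_eq_add_neg, ← C_neg, ← taylor_apply,
    coeff_taylor_of_natDegree_le h1, h2, eulerZigzag]

/-- Two polynomials agreeing at the infinitely many points `s + 1/2` are equal; at these points the
left side counts maps to a chain with `s` elements. The constant subtracted for `n = 1` comes from
the term `-X/2` of the generating function. -/
theorem map_shiftedZigzagPolynomial (n : ℕ) :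
    (shiftedZigzagPolynomial n).map (algebraMap ℚ ℂ) =
      (∑ k ∈ Finset.range (n + 1), C (PowerSeries.coeff k secAddTan *
        PowerSeries.coeff n (cosHalfThetaComplex * thetaComplex ^ k)) * X ^ k) -
      C (if n = 1 then 1 / 2 else 0) := by
  refine Polynomial.eq_of_infinite_eval_eq _ _ ?_
  have hinj : Function.Injective fun s : ℕ => (s : ℂ) + 1 / 2 := fun a b h => by
    simpa using h
  refine (Set.infinite_range_of_injective hinj).mono ?_
  rintro _ ⟨s, rfl⟩
  have h1 := congrArg (PowerSeries.coeff n) (two_mul_zigzagSeries_self s)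
  rw [map_sub, ← map_ofNat (PowerSeries.C (R := ℂ)) 2, PowerSeries.coeff_C_mul,
    PowerSeries.coeff_C_mul, coeff_zigzagSeries n le_rfl, coeff_mul_substTheta,
    PowerSeries.coeff_X, ← card_zigzag_orderHom] at h1
  have h2 : ((shiftedZigzagPolynomial n).map (algebraMap ℚ ℂ)).eval ((s : ℂ) + 1 / 2) =
      Nat.card (Zigzag n →o Fin s) := by
    have h3 : ((s : ℂ) + 1 / 2) = algebraMap ℚ ℂ ((s : ℚ) + 1 / 2) := by simp
    rw [h3, eval_map_algebraMap, aeval_algebraMap_apply, coe_aeval_eq_eval,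
      shiftedZigzagPolynomial, eval_comp]
    simp only [eval_sub, eval_X, eval_C, add_sub_cancel_right]
    rw [orderPolynomial_eval]
    simp
  rw [Set.mem_ofPred_eq, h2, eval_sub, eval_C, eval_finsetSum]
  simp only [eval_mul, eval_C, eval_pow, eval_X]
  have h4 : ∀ k ∈ Finset.range (n + 1), PowerSeries.coeff k secAddTan *
      PowerSeries.coeff n (cosHalfThetaComplex * thetaComplex ^ k) * ((s : ℂ) + 1 / 2) ^ k =
      PowerSeries.coeff k secAddTan * ((s : ℂ) + 1 / 2) ^ k *
        PowerSeries.coeff n (cosHalfThetaComplex * thetaComplex ^ k) := fun k _ => by ring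
  rw [Finset.sum_congr rfl h4]
  split_ifs at h1 ⊢
  · linear_combination h1 / 2
  · linear_combination h1 / 2

theorem coeff_cosHalfThetaComplex_mul_pow (n k : ℕ) :
    PowerSeries.coeff n (cosHalfThetaComplex * thetaComplex ^ k) =
      algebraMap ℚ ℂ (PowerSeries.coeff n (cosHalfTheta * thetaSeries ^ k)) := by
  rw [← PowerSeries.coeff_map, cosHalfThetaComplex, thetaComplex, ← map_pow, ← map_mul]

theorem algebraMap_coeff_shiftedZigzagPolynomial {n k : ℕ} (h : n ≠ 1 ∨ k ≠ 0) :
    algebraMap ℚ ℂ ((shiftedZigzagPolynomial n).coeff k) = PowerSeries.coeff k secAddTan *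
      algebraMap ℚ ℂ (PowerSeries.coeff n (cosHalfTheta * thetaSeries ^ k)) := by
  rw [← coeff_map, map_shiftedZigzagPolynomial, coeff_sub, coeff_C, finsetSum_coeff]
  have h0 : (if k = 0 then (if n = 1 then (1 / 2 : ℂ) else 0) else 0) = 0 := by
    split_ifs <;> simp_all
  rw [h0, sub_zero]
  simp only [coeff_C_mul, coeff_X_pow]
  simp only [mul_ite, mul_one, mul_zero, Finset.sum_ite_eq, Finset.mem_range]
  rw [coeff_cosHalfThetaComplex_mul_pow]
  split_ifs with hk
  · rfl
  · rw [coeff_cosHalfTheta_mul_pow_of_lt (by omega), map_zero, mul_zero]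

/-- André's theorem, read off from leading coefficients: that of an order polynomial counts linear
extensions, and `cos (θ/2) θ^k` has coefficient `1` at `X^k`. -/
theorem coeff_secAddTan {k : ℕ} (hk : 1 ≤ k) :
    PowerSeries.coeff k secAddTan = algebraMap ℚ ℂ ((eulerZigzag k : ℚ) / (k.factorial : ℚ)) := by
  rw [← coeff_shiftedZigzagPolynomial_self,
    algebraMap_coeff_shiftedZigzagPolynomial (Or.inr (by omega)),
    coeff_cosHalfTheta_mul_pow_self, map_one, mul_one]

theorem coeff_shiftedZigzagPolynomial (n : ℕ) {k : ℕ} (hk : 1 ≤ k) :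
    (shiftedZigzagPolynomial n).coeff k = (eulerZigzag k : ℚ) / (k.factorial : ℚ) *
      PowerSeries.coeff n (cosHalfTheta * thetaSeries ^ k) := by
  apply (algebraMap ℚ ℂ).injective
  rw [algebraMap_coeff_shiftedZigzagPolynomial (Or.inr (by omega)), coeff_secAddTan hk,
    ← map_mul]

theorem coeff_shiftedZigzagPolynomial_eq_zero {n k : ℕ} (hn : n ≠ 1) (h : n % 2 ≠ k % 2) :
    (shiftedZigzagPolynomial n).coeff k = 0 := by
  apply (algebraMap ℚ ℂ).injective
  rw [algebraMap_coeff_shiftedZigzagPolynomial (Or.inl hn), coeff_cosHalfTheta_mul_pow_eq_zero h,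
    map_zero, mul_zero]

theorem shiftedZigzagPolynomial_comp_neg_X {n : ℕ} (hn : n ≠ 1) :
    (shiftedZigzagPolynomial n).comp (-X) = (-1) ^ n * shiftedZigzagPolynomial n := by
  ext k
  have hC : ((-1 : ℚ[X])) ^ n = C ((-1 : ℚ) ^ n) := by simp
  have hX : (-X : ℚ[X]) = C (-1) * X := by simp
  rw [hX, comp_C_mul_X_coeff, hC, coeff_C_mul, mul_comm]
  by_cases h : n % 2 = k % 2
  · rw [neg_one_pow_eq_pow_mod_two k, neg_one_pow_eq_pow_mod_two n, h]
  · rw [coeff_shiftedZigzagPolynomial_eq_zero hn h, mul_zero, mul_zero]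

end OrderPolynomialCoefficients

/-! ### Convex subposets of a zigzag are intervals -/

section ZigzagIntervals

theorem Zigzag.exists_idx_eq {n a : ℕ} (h : a < n) : ∃ x : Zigzag n, x.idx = a :=
  ⟨(⟨a, h⟩ : Fin n), rfl⟩

theorem Zigzag.idx_lt {n : ℕ} (x : Zigzag n) : x.idx < n := Fin.isLt (n := n) x

theorem Zigzag.le_iff {n : ℕ} {x y : Zigzag n} :
    x ≤ y ↔ x = y ∨ (Odd x.idx ∧ (y.idx + 1 = x.idx ∨ y.idx = x.idx + 1)) := Iff.rfl

theorem comparabilityGraph_zigzag_adj {n : ℕ} {x y : Zigzag n} :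
    (comparabilityGraph (Zigzag n)).Adj x y ↔ x.idx + 1 = y.idx ∨ y.idx + 1 = x.idx := by
  rw [comparabilityGraph, SimpleGraph.fromRel_adj, Zigzag.le_iff, Zigzag.le_iff]
  constructor
  · rintro ⟨hne, (rfl | ⟨-, h⟩) | (rfl | ⟨-, h⟩)⟩
    · exact absurd rfl hne
    · omega
    · exact absurd rfl hne
    · omega
  · intro h
    refine ⟨fun hxy => by subst hxy; omega, ?_⟩
    rcases Nat.even_or_odd x.idx with he | ho
    · have hy : Odd y.idx := by
        rcases h with h | h
        · rw [← h]; exact he.add_one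
        · rw [← h] at he
          rw [← Nat.not_even_iff_odd]
          intro hy
          exact (Nat.even_add_one.mp he) hy
      exact Or.inr (Or.inr ⟨hy, by omega⟩)
    · exact Or.inl (Or.inr ⟨ho, by omega⟩)

/-- The elements of `Z_n` with (zero-based) index in `[i, j)`. -/
def zigzagInterval (n i j : ℕ) : Finset (Zigzag n) :=
  Finset.univ.filter fun x => i ≤ x.idx ∧ x.idx < j

theorem mem_zigzagInterval {n i j : ℕ} {x : Zigzag n} :
    x ∈ zigzagInterval n i j ↔ i ≤ x.idx ∧ x.idx < j := by
  simp [zigzagInterval]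

theorem exists_eq_zigzagInterval {n : ℕ} {B : Finset (Zigzag n)}
    (hB : ((comparabilityGraph (Zigzag n)).induce (B : Set (Zigzag n))).Connected) :
    ∃ i j, i < j ∧ j ≤ n ∧ B = zigzagInterval n i j := by
  -- A walk inside `B` changes the index by one at each step, so it cannot jump over an element
  -- missing from `B`.
  have hreach (y : Zigzag n) (hy : y ∉ B) (u v : (B : Set (Zigzag n)))
      (hu : u.1.idx < y.idx) : v.1.idx < y.idx := by
    obtain ⟨w⟩ := hB.preconnected u v
    induction w with
    | nil => exact hu
    | @cons u v t huv _ ih =>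
      apply ih
      have h1 := comparabilityGraph_zigzag_adj.mp (SimpleGraph.induce_adj.mp huv)
      have h2 : v.1.idx ≠ y.idx := fun h => hy (Zigzag.idx_injective h ▸ v.2)
      omega
  have hne : B.Nonempty := by
    obtain ⟨x⟩ := hB.nonempty
    exact ⟨x.1, x.2⟩
  obtain ⟨a, ha, hmin⟩ := B.exists_min_image Zigzag.idx hne
  obtain ⟨b, hb, hmax⟩ := B.exists_max_image Zigzag.idx hne
  refine ⟨a.idx, b.idx + 1, by have := hmin b hb; omega, b.idx_lt, ?_⟩
  ext y
  rw [mem_zigzagInterval]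
  constructor
  · intro hy
    have h1 := hmin y hy
    have h2 := hmax y hy
    omega
  · rintro ⟨h1, h2⟩
    by_contra hy
    have h3 : a.idx ≠ y.idx := fun h => hy (Zigzag.idx_injective h ▸ ha)
    have h4 := hreach y hy ⟨a, ha⟩ ⟨b, hb⟩ (by change a.idx < y.idx; omega)
    change b.idx < y.idx at h4
    omega

theorem isConvexSubposet_zigzagInterval {n i j : ℕ} (hij : i < j) (hj : j ≤ n) :
    IsConvexSubposet (zigzagInterval n i j) := by
  constructor
  · rw [SimpleGraph.connected_iff_exists_forall_reachable]
    obtain ⟨a, ha⟩ := Zigzag.exists_idx_eq (show i < n by omega)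
    have haB : a ∈ zigzagInterval n i j := mem_zigzagInterval.mpr (by omega)
    refine ⟨⟨a, haB⟩, ?_⟩
    have key (d : ℕ) (x : Zigzag n) (hx : x ∈ zigzagInterval n i j) (hd : x.idx = i + d) :
        ((comparabilityGraph (Zigzag n)).induce
          (zigzagInterval n i j : Set (Zigzag n))).Reachable ⟨a, haB⟩ ⟨x, hx⟩ := by
      induction d generalizing x with
      | zero =>
        have : a = x := Zigzag.idx_injective (by omega)
        subst this
        exact SimpleGraph.Reachable.refl _
      | succ d ih =>
        have hx' := mem_zigzagInterval.mp hx
        obtain ⟨y, hy⟩ := Zigzag.exists_idx_eq (show i + d < n by omega)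
        have hyB : y ∈ zigzagInterval n i j := mem_zigzagInterval.mpr (by omega)
        refine (ih y hyB hy).trans (SimpleGraph.Adj.reachable ?_)
        rw [SimpleGraph.induce_adj, comparabilityGraph_zigzag_adj]
        exact Or.inl (by change y.idx + 1 = x.idx; omega)
    rintro ⟨x, hx⟩
    have hx' := mem_zigzagInterval.mp hx
    exact key (x.idx - i) x hx (by omega)
  -- Chains have at most two elements, so an element between `x` and `z` is one of them.
  · refine ⟨fun x hx z hz y hy => ?_⟩
    rcases Zigzag.le_iff.mp hy.1 with rfl | ⟨h1, h2⟩
    · exact hx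
    rcases Zigzag.le_iff.mp hy.2 with rfl | ⟨h3, -⟩
    · exact hz
    · rw [Nat.odd_iff] at h1 h3
      omega

theorem isConvexSubposet_zigzag_iff {n : ℕ} {B : Finset (Zigzag n)} :
    IsConvexSubposet B ↔ ∃ i j, i < j ∧ j ≤ n ∧ B = zigzagInterval n i j := by
  constructor
  · exact fun h => exists_eq_zigzagInterval h.1
  · rintro ⟨i, j, hij, hj, rfl⟩
    exact isConvexSubposet_zigzagInterval hij hj

/-- Neighbouring elements of two disjoint intervals are the last element of the left interval and
the first element of the right one. -/
theorem zigzagInterval_adjacent {n i j i' j' : ℕ} (hj : j ≤ n) (hij' : i' < j')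
    (hi : i ≤ i')
    (hd : Disjoint (zigzagInterval n i j) (zigzagInterval n i' j')) {a b : Zigzag n}
    (ha : a ∈ zigzagInterval n i j) (hb : b ∈ zigzagInterval n i' j')
    (hab : a.idx + 1 = b.idx ∨ b.idx + 1 = a.idx) : a.idx + 1 = i' ∧ b.idx = i' := by
  rw [mem_zigzagInterval] at ha hb
  have hji : j ≤ i' := by
    by_contra hlt
    obtain ⟨x, hx⟩ := Zigzag.exists_idx_eq (show i' < n by omega)
    exact Finset.disjoint_left.mp hd (mem_zigzagInterval.mpr (by omega : i ≤ x.idx ∧ x.idx < j))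
      (mem_zigzagInterval.mpr (by omega))
  omega

/-- The rightmost block of a cycle meets both its predecessor and its successor across its left
boundary. The first relation makes the element just left of the boundary lower, the second makes the
one just right of it lower; neighbours cannot both be lower. -/
theorem noBlockCycle_zigzag {n : ℕ} (μ : Finpartition (Finset.univ : Finset (Zigzag n)))
    (hμ : IsConvexDecomposition μ) : NoBlockCycle μ := by
  rintro ⟨r, c, hc, hmem, hle⟩
  choose p q hpq hq hB using fun i => isConvexSubposet_zigzag_iff.mp (hμ (c i) (hmem i))
  obtain ⟨i, -, hi⟩ := Finset.exists_max_image Finset.univ p ⟨0, Finset.mem_univ 0⟩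
  have hdisj (j : Fin (r + 2)) (hji : j ≠ i) :
      Disjoint (zigzagInterval n (p j) (q j)) (zigzagInterval n (p i) (q i)) := by
    rw [← hB, ← hB]
    exact μ.disjoint (hmem j) (hmem i) (hc.ne hji)
  obtain ⟨a, ha, b, hb, hab⟩ := hle (i - 1)
  obtain ⟨a', ha', b', hb', hab'⟩ := hle i
  rw [sub_add_cancel] at hb
  have hn1 : i - 1 ≠ i := by simp
  have hn2 : i + 1 ≠ i := by simp
  rw [hB] at ha hb ha' hb'
  have hd1 := hdisj _ hn1
  have hd2 := hdisj _ hn2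
  have hodd : Odd a.idx ∧ (a.idx + 1 = b.idx ∨ b.idx + 1 = a.idx) := by
    rcases Zigzag.le_iff.mp hab with rfl | ⟨h1, h2⟩
    · exact absurd hb (Finset.disjoint_left.mp hd1 ha)
    · exact ⟨h1, by omega⟩
  have hodd' : Odd a'.idx ∧ (b'.idx + 1 = a'.idx ∨ a'.idx + 1 = b'.idx) := by
    rcases Zigzag.le_iff.mp hab' with rfl | ⟨h1, h2⟩
    · exact absurd ha' (Finset.disjoint_left.mp hd2 hb')
    · exact ⟨h1, by omega⟩
  have h1 := zigzagInterval_adjacent (hq _) (hpq i) (hi _ (Finset.mem_univ _)) hd1 ha hb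
    hodd.2
  have h2 := zigzagInterval_adjacent (hq _) (hpq i) (hi _ (Finset.mem_univ _)) hd2 hb' ha'
    hodd'.2
  obtain ⟨s, hs⟩ := hodd.1
  obtain ⟨t, ht⟩ := hodd'.1
  omega

end ZigzagIntervals

/-! ### Partitions into intervals, built up by the last block -/

section IntervalPartitions

open Classical in
/-- The partitions of the first `m` elements of `Z_n` into `k` intervals, as sets of blocks. -/
noncomputable def intervalPartitions (n : ℕ) : ℕ → ℕ → Finset (Finset (Finset (Zigzag n)))
  | 0, m => if m = 0 then {∅} else ∅
  | k + 1, m => (Finset.range m).biUnion fun i =>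
      (intervalPartitions n k i).image (insert (zigzagInterval n i m))

theorem mem_intervalPartitions {n k m : ℕ} (hm : m ≤ n) {S : Finset (Finset (Zigzag n))} :
    S ∈ intervalPartitions n k m ↔ S.card = k ∧
      (∀ B ∈ S, ∃ i j, i < j ∧ j ≤ m ∧ B = zigzagInterval n i j) ∧
      (S : Set (Finset (Zigzag n))).PairwiseDisjoint id ∧
      ∀ x : Zigzag n, x.idx < m → ∃ B ∈ S, x ∈ B := by
  classical
  induction k generalizing m S with
  | zero =>
    rw [intervalPartitions]
    constructor
    · intro h
      split_ifs at h with h0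
      · rw [Finset.mem_singleton] at h
        subst h h0
        simp
      · simp at h
    · rintro ⟨h1, -, -, h4⟩
      rw [Finset.card_eq_zero] at h1
      subst h1
      rw [if_pos, Finset.mem_singleton]
      by_contra h0
      obtain ⟨x, hx⟩ := Zigzag.exists_idx_eq (show 0 < n by omega)
      obtain ⟨B, hB, -⟩ := h4 x (by omega)
      simp at hB
  | succ k ih =>
    rw [intervalPartitions]
    simp only [Finset.mem_biUnion, Finset.mem_range, Finset.mem_image]
    constructor
    · rintro ⟨i, him, T, hT, rfl⟩
      obtain ⟨h1, h2, h3, h4⟩ := (ih (by omega)).mp hT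
      have hd (B : Finset (Zigzag n)) (hB : B ∈ T) : Disjoint (zigzagInterval n i m) B := by
        obtain ⟨a, b, hab, hb, rfl⟩ := h2 B hB
        refine Finset.disjoint_left.mpr fun x hx hx' => ?_
        rw [mem_zigzagInterval] at hx hx'
        omega
      refine ⟨?_, ?_, ?_, ?_⟩
      · rw [Finset.card_insert_of_notMem, h1]
        intro hmem
        obtain ⟨x, hx⟩ := Zigzag.exists_idx_eq (show i < n by omega)
        have hx' : x ∈ zigzagInterval n i m := mem_zigzagInterval.mpr (by omega)
        exact Finset.disjoint_left.mp (hd _ hmem) hx' hx'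
      · intro B hB
        rcases Finset.mem_insert.mp hB with rfl | hB
        · exact ⟨i, m, him, le_rfl, rfl⟩
        · obtain ⟨a, b, hab, hb, rfl⟩ := h2 B hB
          exact ⟨a, b, hab, by omega, rfl⟩
      · rw [Finset.coe_insert, Set.pairwiseDisjoint_insert]
        exact ⟨h3, fun B hB _ => hd B hB⟩
      · intro x hx
        by_cases hxi : x.idx < i
        · obtain ⟨B, hB, hxB⟩ := h4 x hxi
          exact ⟨B, Finset.mem_insert_of_mem hB, hxB⟩
        · exact ⟨_, Finset.mem_insert_self _ _, mem_zigzagInterval.mpr (by omega)⟩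
    · rintro ⟨h1, h2, h3, h4⟩
      have hm0 : m ≠ 0 := by
        rintro rfl
        obtain ⟨B, hB⟩ := Finset.card_pos.mp (show 0 < S.card by omega)
        obtain ⟨a, b, hab, hb, -⟩ := h2 B hB
        omega
      -- The block containing the last index `m - 1` must end at `m`; it is the one to remove.
      obtain ⟨x, hx⟩ := Zigzag.exists_idx_eq (show m - 1 < n by omega)
      obtain ⟨B, hB, hxB⟩ := h4 x (by omega)
      obtain ⟨i, j, hij, hj, rfl⟩ := h2 B hB
      have hjm : j = m := by
        have := mem_zigzagInterval.mp hxB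
        omega
      subst hjm
      refine ⟨i, hij, S.erase (zigzagInterval n i j), ?_, Finset.insert_erase hB⟩
      rw [ih (by omega)]
      refine ⟨by rw [Finset.card_erase_of_mem hB, h1]; rfl, ?_, ?_, ?_⟩
      · intro B' hB'
        obtain ⟨hne, hB'⟩ := Finset.mem_erase.mp hB'
        obtain ⟨a, b, hab, hb, rfl⟩ := h2 B' hB'
        refine ⟨a, b, hab, ?_, rfl⟩
        have hd : Disjoint (zigzagInterval n a b) (zigzagInterval n i j) := h3 hB' hB hne
        by_contra hlt
        obtain ⟨y, hy⟩ := Zigzag.exists_idx_eq (show b - 1 < n by omega)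
        exact Finset.disjoint_left.mp hd
          (mem_zigzagInterval.mpr (by omega : a ≤ y.idx ∧ y.idx < b))
          (mem_zigzagInterval.mpr (by omega))
      · exact h3.subset (Finset.coe_subset.mpr (Finset.erase_subset _ _))
      · intro y hy
        obtain ⟨B', hB', hyB'⟩ := h4 y (by omega)
        refine ⟨B', Finset.mem_erase.mpr ⟨?_, hB'⟩, hyB'⟩
        rintro rfl
        have := mem_zigzagInterval.mp hyB'
        omega

theorem zigzagInterval_notMem_of_mem_intervalPartitions {n k i m a : ℕ} (hi : i < m)
    (hm : m ≤ n) (ha : a < m) {S : Finset (Finset (Zigzag n))}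
    (hS : S ∈ intervalPartitions n k i) : zigzagInterval n a m ∉ S := by
  intro h
  obtain ⟨p, q, hpq, hq, heq⟩ := ((mem_intervalPartitions (by omega)).mp hS).2.1 _ h
  obtain ⟨x, hx⟩ := Zigzag.exists_idx_eq (show m - 1 < n by omega)
  have hx' : x ∈ zigzagInterval n a m := mem_zigzagInterval.mpr (by omega)
  rw [heq, mem_zigzagInterval] at hx'
  omega

theorem zigzagInterval_left_injective {n a b m : ℕ} (hm : m ≤ n) (ha : a < m) (hb : b < m)
    (h : zigzagInterval n a m = zigzagInterval n b m) : a = b := by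
  obtain ⟨x, hx⟩ := Zigzag.exists_idx_eq (show a < n by omega)
  obtain ⟨y, hy⟩ := Zigzag.exists_idx_eq (show b < n by omega)
  have h1 : x ∈ zigzagInterval n a m := mem_zigzagInterval.mpr (by omega)
  have h2 : y ∈ zigzagInterval n b m := mem_zigzagInterval.mpr (by omega)
  rw [h, mem_zigzagInterval] at h1
  rw [← h, mem_zigzagInterval] at h2
  omega

/-- The weighted sum over the partitions of the first `m` elements of `Z_n` into `k` intervals. -/
noncomputable def intervalPartitionSum (n : ℕ) (w : Finset (Zigzag n) → ℚ) (k m : ℕ) : ℚ :=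
  ∑ S ∈ intervalPartitions n k m, ∏ B ∈ S, w B

theorem intervalPartitionSum_zero (n : ℕ) (w : Finset (Zigzag n) → ℚ) (m : ℕ) :
    intervalPartitionSum n w 0 m = if m = 0 then 1 else 0 := by
  rw [intervalPartitionSum, intervalPartitions]
  split_ifs <;> simp

theorem intervalPartitionSum_succ {n : ℕ} (w : Finset (Zigzag n) → ℚ) (k : ℕ) {m : ℕ}
    (hm : m ≤ n) :
    intervalPartitionSum n w (k + 1) m =
      ∑ i ∈ Finset.range m, intervalPartitionSum n w k i * w (zigzagInterval n i m) := by
  classical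
  simp only [intervalPartitionSum]
  rw [intervalPartitions, Finset.sum_biUnion]
  · refine Finset.sum_congr rfl fun i hi => ?_
    rw [Finset.mem_range] at hi
    rw [Finset.sum_image, Finset.sum_mul]
    · refine Finset.sum_congr rfl fun S hS => ?_
      rw [Finset.prod_insert (zigzagInterval_notMem_of_mem_intervalPartitions hi hm hi hS),
        mul_comm]
    · intro S hS T hT h
      have hS' := zigzagInterval_notMem_of_mem_intervalPartitions hi hm hi hS
      have hT' := zigzagInterval_notMem_of_mem_intervalPartitions hi hm hi hT
      rw [← Finset.erase_insert hS', ← Finset.erase_insert hT']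
      exact congrArg (fun U => Finset.erase U _) h
  · intro i hi j hj hij
    rw [Finset.mem_coe, Finset.mem_range] at hi hj
    refine Finset.disjoint_left.mpr fun U hU hU' => ?_
    obtain ⟨S, hS, rfl⟩ := Finset.mem_image.mp hU
    obtain ⟨T, hT, hTU⟩ := Finset.mem_image.mp hU'
    have h1 : zigzagInterval n i m ∈ insert (zigzagInterval n j m) T := by
      rw [hTU]
      exact Finset.mem_insert_self _ _
    rcases Finset.mem_insert.mp h1 with h1 | h1
    · exact hij (zigzagInterval_left_injective hm hi hj h1)
    · exact zigzagInterval_notMem_of_mem_intervalPartitions hj hm hi hT h1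

theorem sum_SDecompo_zigzag (n k : ℕ) (w : Finset (Zigzag n) → ℚ) :
    ∑ μ ∈ SDecompo (Zigzag n) k, ∏ B ∈ μ.parts, w B = intervalPartitionSum n w k n := by
  classical
  rw [intervalPartitionSum]
  refine Finset.sum_nbij Finpartition.parts ?_ ?_ ?_ fun _ _ => rfl
  · intro μ hμ
    obtain ⟨-, h1, h2, -⟩ := Finset.mem_filter.mp hμ
    rw [mem_intervalPartitions le_rfl]
    refine ⟨h1, fun B hB => isConvexSubposet_zigzag_iff.mp (h2 B hB), μ.disjoint, fun x _ => ?_⟩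
    exact μ.exists_mem (Finset.mem_univ x)
  · exact fun μ _ ν _ h => Finpartition.ext h
  · intro S hS
    obtain ⟨h1, h2, h3, h4⟩ := (mem_intervalPartitions le_rfl).mp (Finset.mem_coe.mp hS)
    have hconv (B : Finset (Zigzag n)) (hB : B ∈ S) : IsConvexSubposet B :=
      isConvexSubposet_zigzag_iff.mpr (h2 B hB)
    let μ : Finpartition (Finset.univ : Finset (Zigzag n)) :=
      { parts := S
        supIndep := Finset.supIndep_iff_pairwiseDisjoint.mpr h3
        sup_parts := by
          refine Finset.eq_univ_of_forall fun x => ?_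
          obtain ⟨B, hB, hx⟩ := h4 x x.idx_lt
          exact Finset.mem_sup.mpr ⟨B, hB, hx⟩
        bot_notMem := fun h => by
          obtain ⟨x⟩ := (hconv _ h).1.nonempty
          simpa using x.2 }
    refine ⟨μ, ?_, rfl⟩
    refine Finset.mem_coe.mpr (Finset.mem_filter.mpr ⟨Finset.mem_univ _, h1, hconv, ?_⟩)
    exact noBlockCycle_zigzag μ hconv

end IntervalPartitions

/-! ### Block weights in terms of the endpoints -/

section BlockWeights

theorem Zigzag.isMin_iff {n : ℕ} (hn : 2 ≤ n) {x : Zigzag n} : IsMin x ↔ Odd x.idx := by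
  constructor
  · intro h
    by_contra hx
    rw [Nat.not_odd_iff_even, Nat.even_iff] at hx
    have hlt := x.idx_lt
    by_cases h0 : x.idx = 0
    · obtain ⟨y, hy⟩ := Zigzag.exists_idx_eq (show 1 < n by omega)
      have hle : y ≤ x := Or.inr ⟨by rw [hy]; exact odd_one, by omega⟩
      have := congrArg Zigzag.idx (h.eq_of_le hle)
      omega
    · obtain ⟨y, hy⟩ := Zigzag.exists_idx_eq (show x.idx - 1 < n by omega)
      have hle : y ≤ x := Or.inr ⟨by rw [Nat.odd_iff]; omega, by omega⟩
      have := congrArg Zigzag.idx (h.eq_of_le hle)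
      omega
  · intro hx y hy
    rcases hy with rfl | ⟨h1, h2⟩
    · exact le_rfl
    · rw [Nat.odd_iff] at hx h1
      omega

theorem Zigzag.isMax_iff {n : ℕ} {x : Zigzag n} : IsMax x ↔ Even x.idx := by
  constructor
  · intro h
    by_contra hx
    rw [Nat.not_even_iff_odd] at hx
    have hlt := x.idx_lt
    have h1 := Nat.odd_iff.mp hx
    obtain ⟨y, hy⟩ := Zigzag.exists_idx_eq (show x.idx - 1 < n by omega)
    have hle : x ≤ y := Or.inr ⟨hx, by omega⟩
    have := congrArg Zigzag.idx (h.eq_of_ge hle)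
    omega
  · intro hx y hy
    rcases hy with rfl | ⟨h1, h2⟩
    · exact le_rfl
    · rw [Nat.odd_iff] at h1
      rw [Nat.even_iff] at hx
      omega

theorem card_filter_zigzagInterval {n i j : ℕ} (hj : j ≤ n) (p : ℕ → Prop) [DecidablePred p] :
    ((zigzagInterval n i j).filter fun x => p x.idx).card =
      ((Finset.Ico i j).filter p).card := by
  rw [← Finset.card_image_of_injective _ (Zigzag.idx_injective (n := n))]
  congr 1
  ext a
  simp only [Finset.mem_image, Finset.mem_filter, mem_zigzagInterval, Finset.mem_Ico]
  constructor
  · rintro ⟨x, hx, rfl⟩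
    exact hx
  · intro ha
    obtain ⟨x, hx⟩ := Zigzag.exists_idx_eq (show a < n by omega)
    exact ⟨x, by rwa [hx], hx⟩

theorem card_zigzagInterval {n i j : ℕ} (hj : j ≤ n) : (zigzagInterval n i j).card = j - i := by
  have h := card_filter_zigzagInterval (i := i) hj fun _ => True
  simpa using h

/-- Lengthening an interval by two adds one element of each parity, so the majority in an interval
of odd length is the parity of its first element. -/
theorem card_filter_Ico_odd_length (i l : ℕ) :
    (Even i → ((Finset.Ico i (i + (2 * l + 1))).filter Odd).card <
      ((Finset.Ico i (i + (2 * l + 1))).filter Even).card) ∧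
    (Odd i → ((Finset.Ico i (i + (2 * l + 1))).filter Even).card <
      ((Finset.Ico i (i + (2 * l + 1))).filter Odd).card) := by
  simp only [Finset.card_filter]
  induction l with
  | zero =>
    simp only [mul_zero, zero_add, Nat.Ico_succ_singleton, Finset.sum_singleton]
    rcases Nat.even_or_odd i with h | h
    · simp [h, Nat.not_odd_iff_even.mpr h]
    · simp [h, Nat.not_even_iff_odd.mpr h]
  | succ l ih =>
    rw [show i + (2 * (l + 1) + 1) = i + (2 * l + 1) + 1 + 1 by ring]
    simp only [Finset.sum_Ico_succ_top (show i ≤ i + (2 * l + 1) + 1 by omega),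
      Finset.sum_Ico_succ_top (show i ≤ i + (2 * l + 1) by omega)]
    have h (a : ℕ) : ((if Odd a then 1 else 0) + if Odd (a + 1) then 1 else 0 : ℕ) = 1 ∧
        ((if Even a then 1 else 0) + if Even (a + 1) then 1 else 0 : ℕ) = 1 := by
      rcases Nat.even_or_odd a with h | h
      · simp [Nat.even_add_one, h]
      · simp [Nat.odd_add_one, h]
    have h1 := h (i + (2 * l + 1))
    exact ⟨fun hi => by have := ih.1 hi; omega, fun hi => by have := ih.2 hi; omega⟩

theorem blockWeight_zigzagInterval {n i j : ℕ} (hn : 2 ≤ n) (hij : i < j) (hj : j ≤ n) :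
    blockWeight (zigzagInterval n i j) =
      if Even (j - i) then 0 else if Even i then wMinus (j - i)
      else if Even n ∧ j = n then uCoeff (j - i) else wPlus (j - i) := by
  classical
  have hmin : ((zigzagInterval n i j).filter fun x => IsMin x).card =
      ((Finset.Ico i j).filter Odd).card := by
    rw [← card_filter_zigzagInterval hj]
    simp only [Zigzag.isMin_iff hn]
  have hmax : ((zigzagInterval n i j).filter fun x => IsMax x).card =
      ((Finset.Ico i j).filter Even).card := by
    rw [← card_filter_zigzagInterval hj]
    simp only [Zigzag.isMax_iff]
  have hspecial : IsSpecialBlock (zigzagInterval n i j) ↔ Even n ∧ j = n := by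
    refine and_congr_right fun _ => ⟨?_, ?_⟩
    · rintro ⟨x, hx, hxn⟩
      rw [mem_zigzagInterval] at hx
      omega
    · rintro rfl
      obtain ⟨x, hx⟩ := Zigzag.exists_idx_eq (show j - 1 < j by omega)
      exact ⟨x, mem_zigzagInterval.mpr (by omega), by omega⟩
  have hlt (hodd : ¬ Even (j - i)) : ((Finset.Ico i j).filter Odd).card <
      ((Finset.Ico i j).filter Even).card ↔ Even i := by
    obtain ⟨l, hl⟩ := Nat.not_even_iff_odd.mp hodd
    obtain rfl : j = i + (2 * l + 1) := by omega
    have h := card_filter_Ico_odd_length i l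
    refine ⟨fun h1 => ?_, h.1⟩
    by_contra hi
    exact absurd (h.2 (Nat.not_even_iff_odd.mp hi)) (by omega)
  simp only [blockWeight, card_zigzagInterval hj]
  by_cases hodd : Even (j - i)
  · rw [if_pos hodd, if_pos hodd]
  · rw [if_neg hodd, if_neg hodd]
    have e1 : ((zigzagInterval n i j).filter fun x => IsMin x).card <
        ((zigzagInterval n i j).filter fun x => IsMax x).card ↔ Even i := by
      rw [hmin, hmax]
      exact hlt hodd
    simp only [e1, hspecial]

end BlockWeights

/-! ### Weighted sums over decompositions as coefficients of series -/

section WeightedSums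

open PowerSeries

/-- The weight of the last block depends on the parity of its start `i`, so it is not a function of
the length alone. Agreement with `W` is therefore required only where `V` has a nonzero coefficient,
in practice on one parity class. -/
theorem sum_range_mul_coeff {V W : PowerSeries ℚ} {m : ℕ} {w : ℕ → ℚ}
    (hW : constantCoeff W = 0)
    (h : ∀ i < m, coeff i V ≠ 0 → w i = coeff (m - i) W) :
    ∑ i ∈ Finset.range m, coeff i V * w i = coeff m (V * W) := by
  rw [coeff_mul, Finset.Nat.sum_antidiagonal_eq_sum_range_succ_mk, Finset.sum_range_succ,
    Nat.sub_self, coeff_zero_eq_constantCoeff_apply, hW, mul_zero, add_zero]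
  refine Finset.sum_congr rfl fun i hi => ?_
  by_cases hV : coeff i V = 0
  · rw [hV, zero_mul, zero_mul]
  · rw [h i (Finset.mem_range.mp hi) hV]

/-- The generating function for sequences of `k` non-special blocks of alternating kinds. -/
noncomputable def alternatingBlockSeries : ℕ → PowerSeries ℚ
  | 0 => 1
  | k + 1 => alternatingBlockSeries k * if Even k then wMinusSeries else wPlusSeries

theorem rescale_alternatingBlockSeries (k : ℕ) :
    rescale (-1) (alternatingBlockSeries k) = (-1) ^ k * alternatingBlockSeries k := by
  induction k with
  | zero => simp [alternatingBlockSeries]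
  | succ k ih =>
    rw [alternatingBlockSeries, map_mul, ih]
    split_ifs
    · rw [rescale_wMinusSeries]
      ring
    · rw [rescale_wPlusSeries]
      ring

theorem alternatingBlockSeries_even (j : ℕ) :
    alternatingBlockSeries (2 * j) = thetaSeries ^ (2 * j) := by
  induction j with
  | zero => simp [alternatingBlockSeries]
  | succ j ih =>
    rw [show 2 * (j + 1) = 2 * j + 1 + 1 by ring, alternatingBlockSeries, alternatingBlockSeries,
      ih, if_pos (by simp), if_neg (by simp), mul_assoc, wMinusSeries_mul_wPlusSeries]
    ring

theorem alternatingBlockSeries_odd (j : ℕ) :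
    alternatingBlockSeries (2 * j + 1) = cosHalfTheta * thetaSeries ^ (2 * j + 1) := by
  rw [alternatingBlockSeries, alternatingBlockSeries_even, if_pos (by simp), wMinusSeries_eq]
  ring

theorem constantCoeff_eq_zero_of_rescale {W : PowerSeries ℚ} (h : rescale (-1) W = -W) :
    constantCoeff W = 0 := by
  rw [← coeff_zero_eq_constantCoeff_apply]
  exact coeff_eq_zero_of_rescale (k := 1) (by rw [h]; ring) (by norm_num)

/-- Induction on the number of blocks. By parity of the series, `k` odd blocks can only end at an
index of the parity of `k`, which decides the kind of the next block. The hypothesis `hns` keeps the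
special block out. -/
theorem intervalPartitionSum_blockWeight {n m : ℕ} (hn : 2 ≤ n) (k : ℕ) (hm : m ≤ n)
    (hns : ¬(Even n ∧ m = n)) :
    intervalPartitionSum n blockWeight k m = coeff m (alternatingBlockSeries k) := by
  induction k generalizing m with
  | zero => rw [intervalPartitionSum_zero, alternatingBlockSeries, coeff_one]
  | succ k ih =>
    rw [intervalPartitionSum_succ _ _ hm, alternatingBlockSeries]
    rw [← sum_range_mul_coeff (w := fun i => blockWeight (zigzagInterval n i m))]
    · refine Finset.sum_congr rfl fun i hi => ?_
      have hi := Finset.mem_range.mp hi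
      rw [ih (by omega) (by omega)]
    · split_ifs
      · exact constantCoeff_eq_zero_of_rescale rescale_wMinusSeries
      · exact constantCoeff_eq_zero_of_rescale rescale_wPlusSeries
    · intro i hi hV
      have hpar : Even i ↔ Even k := by
        rw [Nat.even_iff, Nat.even_iff]
        by_contra hne
        exact hV (coeff_eq_zero_of_rescale (rescale_alternatingBlockSeries k) (by omega))
      rw [blockWeight_zigzagInterval hn hi hm, if_neg hns]
      simp only [hpar]
      by_cases hk : Even k
      · simp [hk, wMinusSeries]
      · simp [hk, wPlusSeries]

theorem intervalPartitionSum_blockWeight_self {n k : ℕ} (hn : 2 ≤ n) (hk : 1 ≤ k) :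
    intervalPartitionSum n blockWeight k n = coeff n (cosHalfTheta * thetaSeries ^ k) := by
  rcases Nat.even_or_odd n with he | ho
  · obtain ⟨k, rfl⟩ : ∃ l, k = l + 1 := ⟨k - 1, by omega⟩
    rw [intervalPartitionSum_succ _ _ le_rfl]
    have h1 : ∀ i ∈ Finset.range n, intervalPartitionSum n blockWeight k i *
        blockWeight (zigzagInterval n i n) = coeff i (alternatingBlockSeries k) *
        blockWeight (zigzagInterval n i n) := fun i hi => by
      have hi := Finset.mem_range.mp hi
      rw [intervalPartitionSum_blockWeight hn k (by omega) (by omega)]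
    rw [Finset.sum_congr rfl h1]
    obtain ⟨j, rfl | rfl⟩ := Nat.even_or_odd' k
    -- An odd number of odd blocks cannot fill an even `n`, so both sides vanish: either the last
    -- block has even size or the preceding blocks contribute zero.
    · rw [coeff_cosHalfTheta_mul_pow_eq_zero (by rw [Nat.even_iff] at he; omega)]
      refine Finset.sum_eq_zero fun i hi => ?_
      have hi := Finset.mem_range.mp hi
      rw [Nat.even_iff] at he
      by_cases hi2 : i % 2 = 0
      · rw [blockWeight_zigzagInterval hn hi le_rfl, if_pos (by rw [Nat.even_iff]; omega), mul_zero]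
      · rw [coeff_eq_zero_of_rescale (rescale_alternatingBlockSeries (2 * j)) (by omega), zero_mul]
    -- The last block starts at a lower element and contains `z_n`, so it is special and is weighted
    -- by the coefficients of `θ`.
    · rw [sum_range_mul_coeff (W := thetaSeries) constantCoeff_thetaSeries,
        alternatingBlockSeries_odd]
      · congr 1
        ring
      · intro i hi hV
        have hpar : ¬ Even i := by
          rw [Nat.even_iff]
          intro hne
          exact hV (coeff_eq_zero_of_rescale (rescale_alternatingBlockSeries _) (by omega))
        rw [blockWeight_zigzagInterval hn hi le_rfl]
        simp [thetaSeries, hpar, he]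
  · rw [intervalPartitionSum_blockWeight hn k le_rfl
      fun h => (Nat.not_even_iff_odd.mpr ho) h.1]
    obtain ⟨j, rfl | rfl⟩ := Nat.even_or_odd' k
    · rw [Nat.odd_iff] at ho
      rw [coeff_cosHalfTheta_mul_pow_eq_zero (by omega),
        coeff_eq_zero_of_rescale (rescale_alternatingBlockSeries _) (by omega)]
    · rw [alternatingBlockSeries_odd]

end WeightedSums

theorem theorem4 (n : ℕ) (hn : 2 ≤ n) :
    (∀ k : ℕ, 1 ≤ k → k ≤ n →
      (n.factorial : ℚ) * (shiftedZigzagPolynomial n).coeff k =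
        (n.factorial : ℚ) / (k.factorial : ℚ) * (eulerZigzag k : ℚ) *
          ∑ μ ∈ SDecompo (Zigzag n) k, decompositionWeight μ) ∧
    (Even n → (shiftedZigzagPolynomial n).comp (-Polynomial.X) = shiftedZigzagPolynomial n) ∧
    (Odd n → (shiftedZigzagPolynomial n).comp (-Polynomial.X) = -shiftedZigzagPolynomial n) := by
  refine ⟨fun k hk _ => ?_, fun he => ?_, fun ho => ?_⟩
  · simp only [decompositionWeight]
    rw [sum_SDecompo_zigzag, intervalPartitionSum_blockWeight_self hn hk,
      coeff_shiftedZigzagPolynomial n hk]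
    ring
  · rw [shiftedZigzagPolynomial_comp_neg_X (by omega), he.neg_one_pow, one_mul]
  · rw [shiftedZigzagPolynomial_comp_neg_X (by omega), ho.neg_one_pow, neg_one_mul]
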